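/- Let $d\ge 2$, let $\alpha_1,\dots,\alpha_d\in[1/2,2]$, and let $\mathbb T^d=\mathbb R^d/\prod_{j=1}^d\alpha_j\mathbb Z$ be the corresponding flat torus with Lebesgue measure. For $n\in\mathbb Z^d$ put $e_n(x)=e^{2\pi i\sum_j n_jx_j/\alpha_j}$ and $Q(n)=\sum_{j}(2\pi n_j/\alpha_j)^2$. For $f\in L^2(\mathbb T^d)$ let $\hat f(n)=\bigl(\prod_j\alpha_j\bigr)^{-1}\int_{\mathbb T^d}f\,\overline{e_n}\,dx$ be its Fourier coefficients, and $e^{it\Delta}f=\sum_{n\in\mathbb Z^d}e^{-itQ(n)}\hat f(n)\,e_n$. Say that the spectrum of $f$ lies in $[-N,N]^d$ if $\hat f(n)=0$ for all $n\in\mathbb Z^d\setminus[-N,N]^d$. Let $$s_0=\tfrac13\ \text{ if } d=2,\qquad s_0=\tfrac d2-\tfrac d{d+1}+\varepsilon\ \text{ if } d\ge3 \text{ is odd},\qquad s_0=\tfrac d2-1+\varepsilon\ \text{ if } d\ge4\text{ is even},$$ where $\varepsilon>0$ is arbitrary. Then for every $T>0$ there is a constant $C>0$, depending only on $d$, $T$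 and (for $d\ge 3$) $\varepsilon$, such that for all $\alpha_1,\dots,\alpha_d\in[1/2,2]$, all real $N\ge1$ and all $f\in L^2(\mathbb T^d)$ with spectrum in $[-N,N]^d$, $$\|e^{it\Delta}f\|^2_{L^4_t([-T,T])L^4_x(\mathbb T^d)}\le C\,N^{s_0}\,\|f\|^2_{L^2(\mathbb T^d)} .$$ -/

import Mathlib

open MeasureTheory

noncomputable section

namespace GeneralTorus

/-- The flat torus `ℝ^d / ∏ⱼ αⱼ ℤ`; for `0 < αⱼ` its `volume` is the Lebesgue measure of total
mass `∏ⱼ αⱼ`. -/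
abbrev Torus {d : ℕ} (α : Fin d → ℝ) : Type := (j : Fin d) → AddCircle (α j)

variable {d : ℕ} (α : Fin d → ℝ)

/-- The character `e_n(x) = exp (2 π i ∑ⱼ nⱼ xⱼ / αⱼ)`. -/
def character (n : Fin d → ℤ) : C(Torus α, ℂ) where
  toFun x := ∏ j, fourier (n j) (x j)
  continuous_toFun := by fun_prop

/-- The eigenvalue of `-Δ` on the character `e_n`: `Q(n) = ∑ⱼ (2 π nⱼ / αⱼ)²`. -/
def symbolQ (n : Fin d → ℤ) : ℝ := ∑ j, (2 * Real.pi * n j / α j) ^ 2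

variable [∀ j, Fact (0 < α j)]

/-- The character `e_n` as an element of `L²`. -/
def characterLp (n : Fin d → ℤ) : Lp ℂ 2 (volume : Measure (Torus α)) :=
  ContinuousMap.toLp (E := ℂ) 2 (volume : Measure (Torus α)) ℂ (character α n)

variable {α}

/-- The Fourier coefficient of `f` at `n ∈ ℤ^d`, so that `f = ∑ₙ (fourierCoefficient f n) e_n`. -/
def fourierCoefficient (f : Lp ℂ 2 (volume : Measure (Torus α))) (n : Fin d → ℤ) : ℂ :=
  ((∏ j, α j : ℝ) : ℂ)⁻¹ * ∫ x : Torus α, (starRingEnd ℂ) (character α n x) * f x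

/-- The spectrum of `f` lies in `[-N, N]^d`. -/
def SpectrumIn (f : Lp ℂ 2 (volume : Measure (Torus α))) (N : ℝ) : Prop :=
  ∀ n : Fin d → ℤ, fourierCoefficient f n ≠ 0 → ∀ j, |(n j : ℝ)| ≤ N

/-- The Schrödinger group `e^{itΔ} f = ∑ₙ e^{-itQ(n)} f̂(n) e_n`, a series in `L²`. -/
def schrodinger (t : ℝ) (f : Lp ℂ 2 (volume : Measure (Torus α))) :
    Lp ℂ 2 (volume : Measure (Torus α)) :=
  ∑' n : Fin d → ℤ,
    (Complex.exp (-Complex.I * t * symbolQ α n) * fourierCoefficient f n) • characterLp α n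

/-- The norm of `L⁴_t L⁴_x` over the time interval `[-T, T]`, with values in `[0, ∞]`. -/
def normL4L4 (T : ℝ) (u : ℝ → Lp ℂ 2 (volume : Measure (Torus α))) : ENNReal :=
  eLpNorm (fun t : ℝ => eLpNorm (u t) 4 (volume : Measure (Torus α))) 4
    (volume.restrict (Set.Icc (-T) T))

/-- The estimate `‖e^{itΔ} f‖²_{L⁴_t(loc) L⁴_x} ≲ N^s ‖f‖²_{L²}` on all `d`-dimensional tori with
periods in `[1/2, 2]`, for `f` with spectrum in `[-N, N]^d`; the constant depends on `d`, on `s`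
and on the length of the time interval only. -/
def StrichartzL4 (d : ℕ) (s : ℝ) : Prop :=
  ∀ T : ℝ, 0 < T → ∃ C : ℝ, 0 < C ∧
    ∀ (α : Fin d → ℝ) [∀ j, Fact (0 < α j)], (∀ j, 1 / 2 ≤ α j ∧ α j ≤ 2) →
      ∀ N : ℝ, 1 ≤ N → ∀ f : Lp ℂ 2 (volume : Measure (Torus α)), SpectrumIn f N →
        normL4L4 T (fun t => schrodinger t f) ^ 2 ≤ ENNReal.ofReal (C * N ^ s * ‖f‖ ^ 2)

end GeneralTorus

end

/-! The fourth power of the `L⁴` norm is the square of the `L²` norm of `(e^{itΔ}f)²`. That square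
is a finite sum over pairs `(n, m)`, oscillating in space with momentum `n + m` and in time with
frequency `Q(n) + Q(m)`. Replace the cutoff to `[-T, T]` by a Gaussian weight. The space-time
integral then becomes a quadratic form in the products of Fourier coefficients. Its kernel vanishes
unless the momenta agree, and it decays like a Gaussian in the difference of the frequencies.
Schur's test bounds the form by the largest number of pairs with a fixed momentum `k` and frequency
in a unit interval. By the parallelogram law `Q(n - m) = 2(Q(n) + Q(m)) - Q(k)`, such a pair is
determined by the lattice point `n - m`, which lies in an ellipsoidal shell of thickness 2. Hence
`ShellBound d (2 * s)` implies the estimate with exponent `s` (`strichartzL4_of_shellBound`), and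
only lattice points remain to be counted.

For `d = 2` the count is Jarník's argument. Three lattice points on a short arc of an ellipse of
size `R` span a triangle whose doubled area is an integer smaller than 1, hence 0, but no three
points of the thin annulus are collinear. So arcs of length about `R^{1/3}` carry at most two points
(`card_upperSector_le`).

For `d = 3, 4` the coordinates are split into two groups, and Cauchy–Schwarz
(`card_add_mem_Ico_sq_le`) decouples the unrelated coefficients `θⱼ`. What survives involves a
single coefficient, where closeness of the values forces an equality of integers, and the divisor
bound finishes (`exists_energy_sq_sub_sq_le`). Higher dimensions follow by slicing. -/

noncomputable section

namespace GeneralTorus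

/-! ### Divisor bound, and Cauchy–Schwarz for additive coincidences -/

section Counting

/-- The divisor bound: `n` has at most `C n ^ ε` divisors. -/
theorem exists_card_divisors_le_rpow {ε : ℝ} (hε : 0 < ε) :
    ∃ C : ℝ, 1 ≤ C ∧ ∀ n : ℕ, n ≠ 0 → (n.divisors.card : ℝ) ≤ C * (n : ℝ) ^ ε := by
  set K : ℝ := 1 + 1 / (ε * Real.log 2) with hK
  have hlog : 0 < Real.log 2 := Real.log_pos (by norm_num)
  have hK1 : 1 ≤ K := by
    have : 0 < 1 / (ε * Real.log 2) := by positivity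
    linarith
  obtain ⟨P, hP⟩ := exists_nat_ge ((2 : ℝ) ^ (1 / ε))
  refine ⟨K ^ P, one_le_pow₀ hK1, fun n hn => ?_⟩
  -- Primes `p ≥ P ≥ 2^{1/ε}` cost nothing, because `a + 1 ≤ 2^a ≤ p^{εa}`. Each of the fewer than
  -- or exactly `P` smaller primes costs a factor `K`, chosen so that `a + 1 ≤ K (1 + a ε log 2)`.
  have key : ∀ p ∈ n.primeFactors, ((n.factorization p + 1 : ℕ) : ℝ) ≤
      (if p < P then K else 1) * (((p : ℝ) ^ n.factorization p) ^ ε) := by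
    intro p hp
    have hp2 : 2 ≤ p := (Nat.prime_of_mem_primeFactors hp).two_le
    have hp2' : (2 : ℝ) ≤ p := by exact_mod_cast hp2
    generalize n.factorization p = a
    have hcomm : ((p : ℝ) ^ a) ^ ε = ((p : ℝ) ^ ε) ^ a := by
      rw [← Real.rpow_natCast, ← Real.rpow_mul (by positivity), mul_comm,
        Real.rpow_mul (by positivity), Real.rpow_natCast]
    rw [hcomm]
    split_ifs with h
    · have h1 : (2 : ℝ) ^ ε ≤ (p : ℝ) ^ ε := Real.rpow_le_rpow (by norm_num) hp2' hε.le
      have h2 : ((2 : ℝ) ^ ε) ^ a ≤ ((p : ℝ) ^ ε) ^ a := by gcongr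
      have h3 : 1 + a * (ε * Real.log 2) ≤ ((2 : ℝ) ^ ε) ^ a := by
        rw [Real.rpow_def_of_pos (by norm_num), ← Real.exp_nat_mul]
        have := Real.add_one_le_exp (a * (Real.log 2 * ε))
        linarith
      have h4 : (a : ℝ) + 1 ≤ K * (1 + a * (ε * Real.log 2)) := by
        have : K * (1 + a * (ε * Real.log 2)) =
            a + 1 + a * (ε * Real.log 2) + 1 / (ε * Real.log 2) := by
          rw [hK]; field_simp; ring
        rw [this]
        have : 0 ≤ a * (ε * Real.log 2) + 1 / (ε * Real.log 2) := by positivity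
        linarith
      push_cast
      exact h4.trans (mul_le_mul_of_nonneg_left (h3.trans h2) (by linarith))
    · have h1 : (2 : ℝ) ≤ (p : ℝ) ^ ε := by
        have : ((2 : ℝ) ^ (1 / ε)) ^ ε ≤ (p : ℝ) ^ ε :=
          Real.rpow_le_rpow (by positivity) (hP.trans (by exact_mod_cast not_lt.mp h)) hε.le
        rwa [← Real.rpow_mul (by norm_num), one_div_mul_cancel hε.ne', Real.rpow_one] at this
      have h2 : ((a + 1 : ℕ) : ℝ) ≤ 2 ^ a := by exact_mod_cast Nat.lt_two_pow_self
      rw [one_mul]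
      exact h2.trans (by gcongr)
  rw [Nat.card_divisors hn]
  push_cast
  push_cast at key
  refine (Finset.prod_le_prod (fun _ _ => by positivity) key).trans ?_
  rw [Finset.prod_mul_distrib]
  have h1 : ∏ p ∈ n.primeFactors, (if p < P then K else 1) ≤ K ^ P := by
    rw [Finset.prod_ite, Finset.prod_const, Finset.prod_const_one, mul_one]
    refine pow_le_pow_right₀ hK1 ?_
    calc _ ≤ (Finset.range P).card := Finset.card_le_card (fun p hp => by
          simp only [Finset.mem_filter] at hp; simpa using hp.2)
      _ = P := Finset.card_range P
  have h2 : ∏ p ∈ n.primeFactors, ((p : ℝ) ^ n.factorization p) ^ ε = (n : ℝ) ^ ε := by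
    rw [Real.finsetProd_rpow _ _ (fun _ _ => by positivity)]
    congr 1
    conv_rhs => rw [← Nat.prod_factorization_pow_eq_self hn]
    rw [Finsupp.prod, Nat.support_factorization]
    push_cast
    rfl
  rw [h2]
  gcongr

variable {ι κ : Type*}

/-- The number of pairs in `A × A` whose values under `f` have distance less than `1`. -/
def energy (A : Finset ι) (f : ι → ℝ) : ℕ :=
  ((A ×ˢ A).filter fun p => |f p.1 - f p.2| < 1).card

theorem sum_card_fiber_sq_le (A : Finset ι) (u : ι → ℤ) (K : Finset ℤ) :
    ∑ k ∈ K, (A.filter fun a => u a = k).card ^ 2 ≤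
      ((A ×ˢ A).filter fun p => u p.1 = u p.2).card := by
  classical
  calc ∑ k ∈ K, (A.filter fun a => u a = k).card ^ 2
      = ∑ k ∈ K, (((A ×ˢ A).filter fun p => u p.1 = u p.2).filter fun p => u p.1 = k).card := by
        refine Finset.sum_congr rfl fun k _ => ?_
        rw [sq, ← Finset.card_product]
        congr 1
        ext p
        simp only [Finset.mem_product, Finset.mem_filter]
        grind
    _ ≤ _ := by
        rw [← Finset.card_biUnion]
        · refine Finset.card_le_card fun p hp => ?_
          simp only [Finset.mem_biUnion, Finset.mem_filter] at hp ⊢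
          tauto
        · intro a _ b _ hab
          rw [Function.onFun, Finset.disjoint_left]
          intro p
          simp only [Finset.mem_filter]
          grind

theorem card_add_eq_sq_le (A : Finset ι) (B : Finset κ) (u : ι → ℤ) (v : κ → ℤ) :
    ((A ×ˢ B).filter fun p => u p.1 = v p.2).card ^ 2 ≤
      ((A ×ˢ A).filter fun p => u p.1 = u p.2).card *
      ((B ×ˢ B).filter fun p => v p.1 = v p.2).card := by
  classical
  have h : ((A ×ˢ B).filter fun p => u p.1 = v p.2).card =
      ∑ k ∈ A.image u, (A.filter fun a => u a = k).card * (B.filter fun b => v b = k).card := by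
    rw [Finset.card_eq_sum_card_fiberwise (f := fun p => u p.1) (t := A.image u)]
    · refine Finset.sum_congr rfl fun k _ => ?_
      rw [← Finset.card_product]
      congr 1
      ext p
      simp only [Finset.mem_product, Finset.mem_filter]
      grind
    · intro p hp
      simp only [Finset.coe_filter, Finset.mem_product, Set.mem_ofPred_eq] at hp
      exact Finset.mem_coe.2 (Finset.mem_image_of_mem u hp.1.1)
  rw [h]
  exact (Finset.sum_mul_sq_le_sq_mul_sq _ _ _).trans
    (Nat.mul_le_mul (sum_card_fiber_sq_le A u _) (sum_card_fiber_sq_le B v _))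

theorem card_floor_eq_le_energy (A : Finset ι) (f : ι → ℝ) (g : ι → ℤ)
    (h : ∀ a b, g a = g b → |f a - f b| < 1) :
    ((A ×ˢ A).filter fun p => g p.1 = g p.2).card ≤ energy A f :=
  Finset.card_le_card (Finset.monotone_filter_right _ fun _ _ hp => h _ _ hp)

/-- After rounding down, `⌊f⌋ + ⌊g - c⌋` can only be `-1`, `0` or `1`. For each of these values
Cauchy–Schwarz over the common integer value separates `f` from `g`. Three classes give the factor 9
in the square. -/
theorem card_add_mem_Ico_sq_le (A : Finset ι) (B : Finset κ) (f : ι → ℝ) (g : κ → ℝ) (c : ℝ) :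
    ((A ×ˢ B).filter fun p => c ≤ f p.1 + g p.2 ∧ f p.1 + g p.2 < c + 2).card ^ 2 ≤
      9 * (energy A f * energy B g) := by
  classical
  set N : ℤ → ℕ := fun s => ((A ×ˢ B).filter fun p => ⌊f p.1⌋ = s - ⌊g p.2 - c⌋).card with hN
  have hNs : ∀ s, N s ^ 2 ≤ energy A f * energy B g := by
    intro s
    refine (card_add_eq_sq_le A B (fun a => ⌊f a⌋) (fun b => s - ⌊g b - c⌋)).trans ?_
    refine Nat.mul_le_mul (card_floor_eq_le_energy A f (fun a => ⌊f a⌋) fun a b h => ?_)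
      (card_floor_eq_le_energy B g (fun b => s - ⌊g b - c⌋) fun a b h => ?_)
    · exact Int.abs_sub_lt_one_of_floor_eq_floor h
    · have := Int.abs_sub_lt_one_of_floor_eq_floor (sub_right_injective h)
      simpa using this
  have hT : ((A ×ˢ B).filter fun p => c ≤ f p.1 + g p.2 ∧ f p.1 + g p.2 < c + 2).card ≤
      N (-1) + N 0 + N 1 := by
    refine (Finset.card_le_card ?_).trans ((Finset.card_union_le _ _).trans
      (Nat.add_le_add_right (Finset.card_union_le _ _) _))
    intro p hp
    simp only [Finset.mem_filter, Finset.mem_union] at hp ⊢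
    obtain ⟨hp, h1, h2⟩ := hp
    have a1 := Int.floor_le (f p.1)
    have a2 := Int.lt_floor_add_one (f p.1)
    have b1 := Int.floor_le (g p.2 - c)
    have b2 := Int.lt_floor_add_one (g p.2 - c)
    have c1 : ((-2 : ℤ) : ℝ) < (⌊f p.1⌋ + ⌊g p.2 - c⌋ : ℤ) := by push_cast; linarith
    have c2 : ((⌊f p.1⌋ + ⌊g p.2 - c⌋ : ℤ) : ℝ) < ((2 : ℤ) : ℝ) := by push_cast; linarith
    rw [Int.cast_lt] at c1 c2
    simp only [hp, true_and]
    omega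
  have h1 := hNs (-1)
  have h2 := hNs 0
  have h3 := hNs 1
  calc _ ≤ (N (-1) + N 0 + N 1) ^ 2 := Nat.pow_le_pow_left hT 2
    _ ≤ 9 * (energy A f * energy B g) := by
      zify at *
      nlinarith [sq_nonneg ((N (-1) : ℤ) - N 0), sq_nonneg ((N (-1) : ℤ) - N 1),
        sq_nonneg ((N 0 : ℤ) - N 1)]

/-- Regrouping `f a + g b - f a' - g b'` as `(f a - f a') + (g b - g b')` turns closeness of two
sums into a window condition to which the decoupling applies. -/
theorem energy_add_sq_le (A : Finset ι) (B : Finset κ) (f : ι → ℝ) (g : κ → ℝ) :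
    energy (A ×ˢ B) (fun p => f p.1 + g p.2) ^ 2 ≤
      9 * (energy (A ×ˢ A) (fun p => f p.1 - f p.2) * energy (B ×ˢ B) fun p => g p.1 - g p.2) := by
  refine le_trans (Nat.pow_le_pow_left ?_ 2) (card_add_mem_Ico_sq_le (A ×ˢ A) (B ×ˢ B)
    (fun p => f p.1 - f p.2) (fun p => g p.1 - g p.2) (-1))
  refine Finset.card_le_card_of_injOn (fun p => ((p.1.1, p.2.1), (p.1.2, p.2.2))) ?_ ?_
  · rintro ⟨⟨a, b⟩, ⟨a', b'⟩⟩ hp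
    simp only [Finset.coe_filter, Finset.mem_product, Set.mem_ofPred_eq, abs_lt] at hp ⊢
    refine ⟨by tauto, by linarith [hp.2.1], by linarith [hp.2.2]⟩
  · rintro ⟨⟨a, b⟩, ⟨a', b'⟩⟩ _ ⟨⟨c, d⟩, ⟨c', d'⟩⟩ _ h
    simp only [Prod.mk.injEq] at h ⊢
    tauto

end Counting

/-! ### Lattice points in ellipsoidal shells, dimension at least three -/

section Shells

/-- In `(x - y)(x + y) = l` the factor `x - y` is a signed divisor of `l`, and it determines `x +
y`. -/
theorem card_sq_sub_sq_eq_le (A : Finset ℤ) {l : ℤ} (hl : l ≠ 0) :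
    ((A ×ˢ A).filter fun q => q.1 ^ 2 - q.2 ^ 2 = l).card ≤ 2 * l.natAbs.divisors.card := by
  classical
  set D : Finset ℤ := l.natAbs.divisors.image (fun k : ℕ => (k : ℤ)) ∪
    l.natAbs.divisors.image (fun k : ℕ => -(k : ℤ)) with hD
  have hDc : D.card ≤ 2 * l.natAbs.divisors.card := by
    rw [two_mul]
    exact (Finset.card_union_le _ _).trans
      (Nat.add_le_add Finset.card_image_le Finset.card_image_le)
  refine le_trans (Finset.card_le_card_of_injOn (fun q => q.1 - q.2) ?_ ?_) hDc
  · intro q hq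
    simp only [Finset.coe_filter, Set.mem_ofPred_eq] at hq
    have hdvd : (q.1 - q.2).natAbs ∈ l.natAbs.divisors := by
      rw [Nat.mem_divisors]
      refine ⟨Int.natAbs_dvd_natAbs.2 ⟨q.1 + q.2, ?_⟩, by simpa using hl⟩
      rw [← hq.2]; ring
    rw [hD, Finset.mem_coe, Finset.mem_union, Finset.mem_image, Finset.mem_image]
    rcases Int.natAbs_eq (q.1 - q.2) with h | h
    · exact Or.inl ⟨_, hdvd, h.symm⟩
    · exact Or.inr ⟨_, hdvd, h.symm⟩
  · intro p hp q hq hpq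
    simp only [Finset.coe_filter, Set.mem_ofPred_eq] at hp hq hpq
    have h1 : (p.1 - p.2) * (p.1 + p.2) = (p.1 - p.2) * (q.1 + q.2) := by
      rw [show (p.1 - p.2) * (q.1 + q.2) = (q.1 - q.2) * (q.1 + q.2) by rw [hpq]]
      linarith [hp.2, hq.2]
    have h0 : p.1 - p.2 ≠ 0 := by
      intro h
      apply hl
      rw [← hp.2, show p.1 ^ 2 - p.2 ^ 2 = (p.1 - p.2) * (p.1 + p.2) by ring, h, zero_mul]
    have h2 := mul_left_cancel₀ h0 h1
    exact Prod.ext (by linarith) (by linarith)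

theorem card_sq_eq_sq_le (A : Finset ℤ) :
    ((A ×ˢ A).filter fun q => q.1 ^ 2 - q.2 ^ 2 = 0).card ≤ 2 * A.card := by
  classical
  calc _ ≤ (A.image (fun x => (x, x)) ∪ A.image (fun x => (x, -x))).card := by
        refine Finset.card_le_card fun q hq => ?_
        simp only [Finset.mem_filter, Finset.mem_product, Finset.mem_union,
          Finset.mem_image] at hq ⊢
        rcases sq_eq_sq_iff_eq_or_eq_neg.1 (sub_eq_zero.1 hq.2) with h | h
        · exact Or.inl ⟨q.1, hq.1.1, Prod.ext rfl h⟩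
        · exact Or.inr ⟨q.1, hq.1.1, Prod.ext rfl (by simp [h])⟩
    _ ≤ _ := by
        rw [two_mul]
        exact (Finset.card_union_le _ _).trans
          (Nat.add_le_add Finset.card_image_le Finset.card_image_le)

theorem eq_of_abs_mul_sub_lt_one {θ : ℝ} (hθ : 1 ≤ θ) {k l : ℤ} (h : |θ * k - θ * l| < 1) :
    k = l := by
  rw [← mul_sub, abs_mul, abs_of_pos (by linarith)] at h
  have h1 : |(k : ℝ) - l| < 1 := by nlinarith [abs_nonneg ((k : ℝ) - l)]
  have h2 : |k - l| < 1 := by exact_mod_cast h1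
  exact sub_eq_zero.1 (Int.abs_lt_one_iff.1 h2)

theorem energy_sq_le {θ : ℝ} (hθ : 1 ≤ θ) (A : Finset ℤ) :
    energy A (fun x => θ * (x : ℝ) ^ 2) ≤ 2 * A.card := by
  refine le_trans (Finset.card_le_card ?_) (card_sq_eq_sq_le A)
  refine Finset.monotone_filter_right _ fun p _ hp => ?_
  exact sub_eq_zero.2 (eq_of_abs_mul_sub_lt_one hθ (by exact_mod_cast hp))

/-- The integers of absolute value at most `M`. -/
def symIcc (M : ℕ) : Finset ℤ := Finset.Icc (-(M : ℤ)) M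

theorem card_symIcc (M : ℕ) : (symIcc M).card = 2 * M + 1 := by
  rw [symIcc, Int.card_Icc]; omega

/-- As `θ ≥ 1` multiplies integers, distance less than 1 means equality: the quantity counts
solutions of `x² - y² = z² - w²`. The degenerate value 0 contributes `O(M)` choices on each side,
and every other value has `O(M^ε)` representations by the divisor bound. -/
theorem exists_energy_sq_sub_sq_le {ε : ℝ} (hε : 0 < ε) :
    ∃ C : ℝ, 0 < C ∧ ∀ θ : ℝ, 1 ≤ θ → ∀ M : ℕ, 1 ≤ M →
      (energy (symIcc M ×ˢ symIcc M)
        (fun p => θ * (p.1 : ℝ) ^ 2 - θ * (p.2 : ℝ) ^ 2) : ℝ) ≤ C * (M : ℝ) ^ (2 + ε) := by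
  classical
  obtain ⟨C, hC1, hC⟩ := exists_card_divisors_le_rpow (half_pos hε)
  refine ⟨9 * (4 + 2 * C), by positivity, fun θ hθ M hM => ?_⟩
  have hM1 : (1 : ℝ) ≤ M := by exact_mod_cast hM
  set A := symIcc M
  set P := A ×ˢ A
  have hAc : (A.card : ℝ) ≤ 3 * M := by rw [card_symIcc]; push_cast; linarith
  have hPc : (P.card : ℝ) ≤ 9 * (M : ℝ) ^ 2 := by
    rw [Finset.card_product]; push_cast
    nlinarith [Nat.cast_nonneg (α := ℝ) A.card]
  have hpow : (1 : ℝ) ≤ (M : ℝ) ^ ε := Real.one_le_rpow hM1 hε.le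
  let r : ℤ × ℤ → ℕ := fun p => (P.filter fun q => q.1 ^ 2 - q.2 ^ 2 = p.1 ^ 2 - p.2 ^ 2).card
  have h1 : energy P (fun p => θ * (p.1 : ℝ) ^ 2 - θ * (p.2 : ℝ) ^ 2) ≤ ∑ p ∈ P, r p := by
    rw [energy, ← Finset.card_sigma]
    refine Finset.card_le_card_of_injOn (fun x => ⟨x.1, x.2⟩) ?_ ?_
    · intro x hx
      simp only [Finset.coe_filter, Finset.mem_product, Set.mem_ofPred_eq, Finset.coe_sigma,
        Set.mem_sigma_iff, Finset.mem_coe] at hx ⊢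
      refine ⟨hx.1.1, hx.1.2, ?_⟩
      symm
      refine eq_of_abs_mul_sub_lt_one hθ ?_
      push_cast
      rw [mul_sub, mul_sub]
      exact hx.2
    · rintro ⟨x, y⟩ _ ⟨x', y'⟩ _ h
      simpa using h
  have h2 : ∀ p ∈ P, (r p : ℝ) ≤
      (if p.1 ^ 2 - p.2 ^ 2 = 0 then 6 * (M : ℝ) else 0) + 2 * C * (M : ℝ) ^ ε := by
    intro p hp
    have hpos : 0 ≤ 2 * C * (M : ℝ) ^ ε := by positivity
    split_ifs with h0
    · have : r p ≤ 2 * A.card := by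
        simp only [r, h0]; exact card_sq_eq_sq_le A
      have : (r p : ℝ) ≤ 2 * A.card := by exact_mod_cast this
      linarith
    · have h3 : (r p : ℝ) ≤ 2 * ((p.1 ^ 2 - p.2 ^ 2).natAbs.divisors.card : ℝ) := by
        exact_mod_cast card_sq_sub_sq_eq_le A h0
      have h4 := hC _ (Int.natAbs_ne_zero.2 h0)
      have h5 : (((p.1 ^ 2 - p.2 ^ 2).natAbs : ℕ) : ℝ) ≤ (M : ℝ) ^ 2 := by
        have hp' := Finset.mem_product.1 hp
        have hx := Finset.mem_Icc.1 hp'.1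
        have hy := Finset.mem_Icc.1 hp'.2
        have : (((p.1 ^ 2 - p.2 ^ 2).natAbs : ℕ) : ℤ) ≤ (M : ℤ) ^ 2 := by
          rw [Int.natCast_natAbs, abs_le]
          constructor <;> nlinarith
        exact_mod_cast this
      have h6 : (((p.1 ^ 2 - p.2 ^ 2).natAbs : ℕ) : ℝ) ^ (ε / 2) ≤ (M : ℝ) ^ ε := by
        refine (Real.rpow_le_rpow (by positivity) h5 (by positivity)).trans_eq ?_
        rw [← Real.rpow_natCast, ← Real.rpow_mul (by positivity)]
        congr 1; push_cast; ring
      nlinarith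
  have h3 : ∑ p ∈ P, (if p.1 ^ 2 - p.2 ^ 2 = 0 then 6 * (M : ℝ) else 0) ≤ 36 * (M : ℝ) ^ 2 := by
    rw [← Finset.sum_filter, Finset.sum_const, nsmul_eq_mul]
    have : ((P.filter fun q => q.1 ^ 2 - q.2 ^ 2 = 0).card : ℝ) ≤ 2 * A.card := by
      exact_mod_cast card_sq_eq_sq_le A
    nlinarith
  calc (energy P (fun p => θ * (p.1 : ℝ) ^ 2 - θ * (p.2 : ℝ) ^ 2) : ℝ)
      ≤ ∑ p ∈ P, (r p : ℝ) := by exact_mod_cast h1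
    _ ≤ _ := Finset.sum_le_sum h2
    _ ≤ 36 * (M : ℝ) ^ 2 + 9 * (M : ℝ) ^ 2 * (2 * C * (M : ℝ) ^ ε) := by
        rw [Finset.sum_add_distrib, Finset.sum_const, nsmul_eq_mul]
        gcongr
    _ ≤ 9 * (4 + 2 * C) * ((M : ℝ) ^ 2 * (M : ℝ) ^ ε) := by
        nlinarith [sq_nonneg (M : ℝ)]
    _ = _ := by
        rw [Real.rpow_add (by positivity), Real.rpow_ofNat]

theorem exists_energy_sq_add_sq_le {ε : ℝ} (hε : 0 < ε) :
    ∃ C : ℝ, 0 < C ∧ ∀ θ η : ℝ, 1 ≤ θ → 1 ≤ η → ∀ M : ℕ, 1 ≤ M →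
      (energy (symIcc M ×ˢ symIcc M)
        (fun p => θ * (p.1 : ℝ) ^ 2 + η * (p.2 : ℝ) ^ 2) : ℝ) ≤ C * (M : ℝ) ^ (2 + ε) := by
  obtain ⟨C, hC0, hC⟩ := exists_energy_sq_sub_sq_le hε
  refine ⟨3 * C, by positivity, fun θ η hθ hη M hM => ?_⟩
  have h := energy_add_sq_le (symIcc M) (symIcc M) (fun x => θ * (x : ℝ) ^ 2)
    (fun x => η * (x : ℝ) ^ 2)
  have h' : (energy (symIcc M ×ˢ symIcc M)
      (fun p => θ * (p.1 : ℝ) ^ 2 + η * (p.2 : ℝ) ^ 2) : ℝ) ^ 2 ≤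
      9 * ((energy (symIcc M ×ˢ symIcc M)
        (fun p => θ * (p.1 : ℝ) ^ 2 - θ * (p.2 : ℝ) ^ 2) : ℝ) *
      (energy (symIcc M ×ˢ symIcc M)
        (fun p => η * (p.1 : ℝ) ^ 2 - η * (p.2 : ℝ) ^ 2) : ℝ)) := by exact_mod_cast h
  refine le_of_sq_le_sq ?_ (by positivity)
  refine h'.trans ?_
  have := mul_le_mul (hC θ hθ M hM) (hC η hη M hM) (by positivity) (by positivity)
  nlinarith

/-- The points of `ℤ ^ d` in the cube of side `2 M` and in the shell `c ≤ ∑ θⱼ mⱼ² < c + 2`. -/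
def shell {d : ℕ} (θ : Fin d → ℝ) (M : ℕ) (c : ℝ) : Finset (Fin d → ℤ) :=
  (Fintype.piFinset fun _ => symIcc M).filter fun m =>
    c ≤ ∑ j, θ j * (m j : ℝ) ^ 2 ∧ ∑ j, θ j * (m j : ℝ) ^ 2 < c + 2

/-- Ellipsoidal shells with coefficients in `[9, 160]` contain `O(M ^ e)` lattice points of the
cube of side `2 M`, uniformly. -/
def ShellBound (d : ℕ) (e : ℝ) : Prop :=
  ∃ C : ℝ, 0 < C ∧ ∀ θ : Fin d → ℝ, (∀ j, 9 ≤ θ j ∧ θ j ≤ 160) → ∀ M : ℕ, 1 ≤ M → ∀ c : ℝ,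
    ((shell θ M c).card : ℝ) ≤ C * (M : ℝ) ^ e

theorem ShellBound.mono {d : ℕ} {e e' : ℝ} (h : ShellBound d e) (he : e ≤ e') :
    ShellBound d e' := by
  obtain ⟨C, hC, h⟩ := h
  refine ⟨C, hC, fun θ hθ M hM c => (h θ hθ M hM c).trans ?_⟩
  have : (1 : ℝ) ≤ M := by exact_mod_cast hM
  gcongr

theorem shellBound_three {ε : ℝ} (hε : 0 < ε) : ShellBound 3 (3 / 2 + ε) := by
  -- The square of the count is at most a constant times `M^{2 + 2ε} · M`, from two coordinates
  -- against one; hence `2 * ε` here.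
  obtain ⟨C, hC0, hC⟩ := exists_energy_sq_add_sq_le (ε := 2 * ε) (by positivity)
  refine ⟨Real.sqrt (54 * C), by positivity, fun θ hθ M hM c => ?_⟩
  have hM1 : (1 : ℝ) ≤ M := by exact_mod_cast hM
  set A := symIcc M with hA
  have h1 : (shell θ M c).card ≤ (((A ×ˢ A) ×ˢ A).filter fun p =>
      c ≤ (θ 0 * (p.1.1 : ℝ) ^ 2 + θ 1 * (p.1.2 : ℝ) ^ 2) + θ 2 * (p.2 : ℝ) ^ 2 ∧
      (θ 0 * (p.1.1 : ℝ) ^ 2 + θ 1 * (p.1.2 : ℝ) ^ 2) + θ 2 * (p.2 : ℝ) ^ 2 < c + 2).card := by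
    refine Finset.card_le_card_of_injOn (fun m => ((m 0, m 1), m 2)) ?_ ?_
    · intro m hm
      simp only [shell, Finset.coe_filter, Fintype.mem_piFinset, Set.mem_ofPred_eq,
        Fin.sum_univ_three, Finset.mem_product] at hm ⊢
      exact ⟨⟨⟨hm.1 0, hm.1 1⟩, hm.1 2⟩, hm.2⟩
    · intro m _ m' _ h
      simp only [Prod.mk.injEq] at h
      ext j
      fin_cases j
      exacts [h.1.1, h.1.2, h.2]
  have h2 := card_add_mem_Ico_sq_le (A ×ˢ A) A
    (fun p => θ 0 * (p.1 : ℝ) ^ 2 + θ 1 * (p.2 : ℝ) ^ 2) (fun x => θ 2 * (x : ℝ) ^ 2) c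
  have h3 : ((shell θ M c).card : ℝ) ^ 2 ≤ 9 * ((energy (A ×ˢ A)
      (fun p => θ 0 * (p.1 : ℝ) ^ 2 + θ 1 * (p.2 : ℝ) ^ 2) : ℝ) *
      (energy A (fun x => θ 2 * (x : ℝ) ^ 2) : ℝ)) := by
    exact_mod_cast (Nat.pow_le_pow_left h1 2).trans h2
  have h4 : (energy A (fun x => θ 2 * (x : ℝ) ^ 2) : ℝ) ≤ 6 * M := by
    have : (energy A (fun x => θ 2 * (x : ℝ) ^ 2) : ℝ) ≤ 2 * A.card := by
      exact_mod_cast energy_sq_le (by linarith [(hθ 2).1]) A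
    rw [hA, card_symIcc] at this
    push_cast at this
    linarith
  have h5 := hC (θ 0) (θ 1) (by linarith [(hθ 0).1]) (by linarith [(hθ 1).1]) M hM
  refine le_of_sq_le_sq ?_ (by positivity)
  calc _ ≤ _ := h3
    _ ≤ 9 * ((C * (M : ℝ) ^ (2 + 2 * ε)) * (6 * M)) := by gcongr
    _ = _ := by
      have : ((M : ℝ) ^ (3 / 2 + ε)) ^ 2 = (M : ℝ) ^ (2 + 2 * ε) * M := by
        rw [← Real.rpow_natCast, ← Real.rpow_mul (by positivity)]
        nth_rewrite 3 [← Real.rpow_one (M : ℝ)]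
        rw [← Real.rpow_add (by positivity)]
        congr 1; push_cast; ring
      rw [mul_pow, Real.sq_sqrt (by positivity), this]; ring

theorem shellBound_four {ε : ℝ} (hε : 0 < ε) : ShellBound 4 (2 + ε) := by
  obtain ⟨C, hC0, hC⟩ := exists_energy_sq_add_sq_le hε
  refine ⟨3 * C, by positivity, fun θ hθ M hM c => ?_⟩
  set A := symIcc M with hA
  have h1 : (shell θ M c).card ≤ (((A ×ˢ A) ×ˢ (A ×ˢ A)).filter fun p =>
      c ≤ (θ 0 * (p.1.1 : ℝ) ^ 2 + θ 1 * (p.1.2 : ℝ) ^ 2) +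
        (θ 2 * (p.2.1 : ℝ) ^ 2 + θ 3 * (p.2.2 : ℝ) ^ 2) ∧
      (θ 0 * (p.1.1 : ℝ) ^ 2 + θ 1 * (p.1.2 : ℝ) ^ 2) +
        (θ 2 * (p.2.1 : ℝ) ^ 2 + θ 3 * (p.2.2 : ℝ) ^ 2) < c + 2).card := by
    refine Finset.card_le_card_of_injOn (fun m => ((m 0, m 1), (m 2, m 3))) ?_ ?_
    · intro m hm
      simp only [shell, Finset.coe_filter, Fintype.mem_piFinset, Set.mem_ofPred_eq,
        Fin.sum_univ_four, Finset.mem_product] at hm ⊢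
      exact ⟨⟨⟨hm.1 0, hm.1 1⟩, ⟨hm.1 2, hm.1 3⟩⟩, by linarith, by linarith⟩
    · intro m _ m' _ h
      simp only [Prod.mk.injEq] at h
      ext j
      fin_cases j
      exacts [h.1.1, h.1.2, h.2.1, h.2.2]
  have h2 := card_add_mem_Ico_sq_le (A ×ˢ A) (A ×ˢ A)
    (fun p => θ 0 * (p.1 : ℝ) ^ 2 + θ 1 * (p.2 : ℝ) ^ 2)
    (fun p => θ 2 * (p.1 : ℝ) ^ 2 + θ 3 * (p.2 : ℝ) ^ 2) c
  have h3 : ((shell θ M c).card : ℝ) ^ 2 ≤ 9 * ((energy (A ×ˢ A)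
      (fun p => θ 0 * (p.1 : ℝ) ^ 2 + θ 1 * (p.2 : ℝ) ^ 2) : ℝ) * (energy (A ×ˢ A)
      (fun p => θ 2 * (p.1 : ℝ) ^ 2 + θ 3 * (p.2 : ℝ) ^ 2) : ℝ)) := by
    exact_mod_cast (Nat.pow_le_pow_left h1 2).trans h2
  have h5 := hC (θ 0) (θ 1) (by linarith [(hθ 0).1]) (by linarith [(hθ 1).1]) M hM
  have h6 := hC (θ 2) (θ 3) (by linarith [(hθ 2).1]) (by linarith [(hθ 3).1]) M hM
  refine le_of_sq_le_sq ?_ (by positivity)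
  have := mul_le_mul h5 h6 (by positivity) (by positivity)
  nlinarith

/-- Fixing the first coordinate, in `2M + 1 ≤ 3M` ways, leaves a shell of the same thickness one
dimension lower; uniformity in the centre `c` is what makes this work. -/
theorem ShellBound.succ {d : ℕ} {e : ℝ} (h : ShellBound d e) : ShellBound (d + 1) (e + 1) := by
  classical
  obtain ⟨C, hC0, h⟩ := h
  refine ⟨3 * C, by positivity, fun θ hθ M hM c => ?_⟩
  have hM1 : (1 : ℝ) ≤ M := by exact_mod_cast hM
  have h1 : (shell θ M c).card ≤
      ∑ x ∈ symIcc M, (shell (fun j => θ j.succ) M (c - θ 0 * (x : ℝ) ^ 2)).card := by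
    rw [← Finset.card_sigma]
    refine Finset.card_le_card_of_injOn (fun m => ⟨m 0, fun j => m j.succ⟩) ?_ ?_
    · intro m hm
      simp only [shell, Finset.coe_filter, Fintype.mem_piFinset, Set.mem_ofPred_eq,
        Fin.sum_univ_succ, Finset.coe_sigma, Set.mem_sigma_iff, Finset.mem_coe] at hm ⊢
      exact ⟨hm.1 0, fun j => hm.1 j.succ, by linarith, by linarith⟩
    · intro m _ m' _ h
      simp only [Sigma.mk.injEq, heq_eq_eq] at h
      ext j
      exact Fin.cases h.1 (fun i => congrFun h.2 i) j
  calc ((shell θ M c).card : ℝ)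
      ≤ ∑ x ∈ symIcc M, ((shell (fun j => θ j.succ) M (c - θ 0 * (x : ℝ) ^ 2)).card : ℝ) := by
        exact_mod_cast h1
    _ ≤ ∑ _x ∈ symIcc M, C * (M : ℝ) ^ e :=
        Finset.sum_le_sum fun x _ => h _ (fun j => hθ j.succ) M hM _
    _ = (2 * M + 1) * (C * (M : ℝ) ^ e) := by
        rw [Finset.sum_const, card_symIcc, nsmul_eq_mul]; push_cast; ring
    _ ≤ (3 * M) * (C * (M : ℝ) ^ e) := by gcongr; linarith
    _ = 3 * C * (M : ℝ) ^ (e + 1) := by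
        rw [Real.rpow_add (by positivity), Real.rpow_one]; ring

theorem shellBound_of_four_le {d : ℕ} (hd : 4 ≤ d) {ε : ℝ} (hε : 0 < ε) :
    ShellBound d ((d : ℝ) - 2 + ε) := by
  induction d, hd using Nat.le_induction with
  | base => convert shellBound_four hε using 2; norm_num
  | succ n _ ih => convert ih.succ using 1; push_cast; ring

end Shells

/-! ### Dimension two: Jarník's argument in an elliptic annulus -/

section EllipticAnnulus

/-- Three collinear points of an elliptic annulus, the first of them in the middle, are close to
each other. -/
theorem inner_gt_of_collinear {a b c x y X Y Z W : ℝ}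
    (hD : X * W - Z * Y = 0) (hB : a * X * Z + b * Y * W ≤ 0) (hQ : 0 < a * X ^ 2 + b * Y ^ 2)
    (h0 : c ≤ a * x ^ 2 + b * y ^ 2)
    (h1 : a * (x + X) ^ 2 + b * (y + Y) ^ 2 < c + 2)
    (h2 : a * (x + Z) ^ 2 + b * (y + W) ^ 2 < c + 2) :
    -2 < a * X * Z + b * Y * W := by
  set B := a * X * Z + b * Y * W with hBdef
  set Q := a * X ^ 2 + b * Y ^ 2 with hQdef
  -- On a line `(Z, W) = λ (X, Y)` with `B = λ Q`. This combination cancels the linear terms of the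
  -- two increments and leaves only the convexity of the form.
  have key : Q * (a * (x + Z) ^ 2 + b * (y + W) ^ 2 - (a * x ^ 2 + b * y ^ 2)) -
      B * (a * (x + X) ^ 2 + b * (y + Y) ^ 2 - (a * x ^ 2 + b * y ^ 2)) = -B * (Q - B) := by
    rw [hBdef, hQdef]
    linear_combination (2 * a * b * (X * y - Y * x) + a * b * (X * W - Z * Y)) * hD
  by_contra hcon
  push Not at hcon
  have e1 : Q * (a * (x + Z) ^ 2 + b * (y + W) ^ 2 - (a * x ^ 2 + b * y ^ 2)) < Q * 2 :=
    mul_lt_mul_of_pos_left (by linarith) hQ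
  have e2 : -B * (a * (x + X) ^ 2 + b * (y + Y) ^ 2 - (a * x ^ 2 + b * y ^ 2)) ≤ -B * 2 :=
    mul_le_mul_of_nonneg_left (by linarith) (by linarith)
  nlinarith

theorem nine_le_form {a b : ℝ} (ha : 9 ≤ a) (hb : 9 ≤ b) {X Y : ℤ} (h : ¬ (X = 0 ∧ Y = 0)) :
    9 ≤ a * (X : ℝ) ^ 2 + b * (Y : ℝ) ^ 2 := by
  have h1 : 1 ≤ X ^ 2 + Y ^ 2 := by
    by_contra hc
    exact h ⟨by nlinarith [sq_nonneg X, sq_nonneg Y], by nlinarith [sq_nonneg X, sq_nonneg Y]⟩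
  have h2 : (1 : ℝ) ≤ (X : ℝ) ^ 2 + (Y : ℝ) ^ 2 := by exact_mod_cast h1
  nlinarith [sq_nonneg (X : ℝ), sq_nonneg (Y : ℝ)]

/-- The points `p` of the plane with `c ≤ a p₁² + b p₂² < c + 2`. -/
def InAnnulus (a b c : ℝ) (p : ℤ × ℤ) : Prop :=
  c ≤ a * (p.1 : ℝ) ^ 2 + b * (p.2 : ℝ) ^ 2 ∧ a * (p.1 : ℝ) ^ 2 + b * (p.2 : ℝ) ^ 2 < c + 2

/-- Were `p` between `q` and `r`, the inner product would lie in `(-2, 0]`. For parallel vectors its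
square is the product of the two values of the form, which is at least 81. -/
theorem inner_pos_of_collinear {a b c : ℝ} (ha : 9 ≤ a) (hb : 9 ≤ b) {p q r : ℤ × ℤ}
    (hp : InAnnulus a b c p) (hq : InAnnulus a b c q) (hr : InAnnulus a b c r)
    (hpq : p ≠ q) (hpr : p ≠ r)
    (hD : (q.1 - p.1) * (r.2 - p.2) - (r.1 - p.1) * (q.2 - p.2) = 0) :
    0 < a * (q.1 - p.1) * (r.1 - p.1) + b * (q.2 - p.2) * (r.2 - p.2 : ℝ) := by
  have hD' : ((q.1 : ℝ) - p.1) * (r.2 - p.2) - (r.1 - p.1) * (q.2 - p.2) = 0 := by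
    exact_mod_cast hD
  have h1 := nine_le_form ha hb (X := q.1 - p.1) (Y := q.2 - p.2)
    (fun h => hpq (Prod.ext (by linarith [h.1]) (by linarith [h.2])))
  have h2 := nine_le_form ha hb (X := r.1 - p.1) (Y := r.2 - p.2)
    (fun h => hpr (Prod.ext (by linarith [h.1]) (by linarith [h.2])))
  push_cast at h1 h2
  by_contra hB
  push Not at hB
  have h3 := inner_gt_of_collinear (x := p.1) (y := p.2) (c := c) hD' hB (by linarith) hp.1
    (by simpa using hq.2) (by simpa using hr.2)
  have h4 : (a * (q.1 - p.1) * (r.1 - p.1) + b * (q.2 - p.2) * (r.2 - p.2 : ℝ)) ^ 2 =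
      (a * ((q.1 : ℝ) - p.1) ^ 2 + b * ((q.2 : ℝ) - p.2) ^ 2) *
      (a * ((r.1 : ℝ) - p.1) ^ 2 + b * ((r.2 : ℝ) - p.2) ^ 2) := by
    linear_combination (-(a * b) * (((q.1 : ℝ) - p.1) * (r.2 - p.2) -
      (r.1 - p.1) * (q.2 - p.2))) * hD'
  have h5 := mul_le_mul h1 h2 (by norm_num) (by linarith)
  nlinarith

/-- A line meets an elliptic annulus in at most two lattice points. -/
theorem det_ne_zero_of_inAnnulus {a b c : ℝ} (ha : 9 ≤ a) (hb : 9 ≤ b) {p q r : ℤ × ℤ}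
    (hp : InAnnulus a b c p) (hq : InAnnulus a b c q) (hr : InAnnulus a b c r)
    (hpq : p ≠ q) (hpr : p ≠ r) (hqr : q ≠ r) :
    (q.1 - p.1) * (r.2 - p.2) - (r.1 - p.1) * (q.2 - p.2) ≠ 0 := by
  intro hD
  have hD' : ((q.1 : ℝ) - p.1) * (r.2 - p.2) - (r.1 - p.1) * (q.2 - p.2) = 0 := by
    exact_mod_cast hD
  have h1 := inner_pos_of_collinear ha hb hp hq hr hpq hpr hD
  have h2 := inner_pos_of_collinear ha hb hq hp hr hpq.symm hqr (by linarith)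
  have h3 := inner_pos_of_collinear ha hb hr hp hq hpr.symm hqr.symm (by linarith)
  set B := a * (q.1 - p.1) * (r.1 - p.1) + b * (q.2 - p.2) * (r.2 - p.2 : ℝ) with hB
  set B1 := a * (p.1 - q.1) * (r.1 - q.1) + b * (p.2 - q.2) * (r.2 - q.2 : ℝ) with hB1
  set B2 := a * (p.1 - r.1) * (q.1 - r.1) + b * (p.2 - r.2) * (q.2 - r.2 : ℝ) with hB2
  -- `B + B1` and `B + B2` are the squared lengths of `q - p` and `r - p`, so this is equality in
  -- Cauchy–Schwarz. It is impossible with all three inner products positive: one of three collinear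
  -- points is in the middle.
  have h4 : B ^ 2 = (B + B1) * (B + B2) := by
    rw [hB, hB1, hB2]
    linear_combination (-(a * b) * (((q.1 : ℝ) - p.1) * (r.2 - p.2) -
      (r.1 - p.1) * (q.2 - p.2))) * hD'
  nlinarith [mul_pos h1 h2, mul_pos h1 h3, mul_pos h2 h3]

/-- In the sector `|x| ≤ y` the ellipse has slope at most `a / b ≤ 160 / 9 < 18`; the thickness of
the annulus adds at most 1. -/
theorem abs_sub_snd_le {a b c L : ℝ} (ha : 9 ≤ a ∧ a ≤ 160) (hb : 9 ≤ b) {p q : ℤ × ℤ}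
    (hp : InAnnulus a b c p) (hq : InAnnulus a b c q) (hp1 : |p.1| ≤ p.2) (hq1 : |q.1| ≤ q.2)
    (hp2 : 1 ≤ p.2) (hq2 : 1 ≤ q.2) (hL : |(q.1 : ℝ) - p.1| ≤ L) :
    |(q.2 : ℝ) - p.2| ≤ 18 * L + 1 := by
  have p1 : |(p.1 : ℝ)| ≤ p.2 := by exact_mod_cast hp1
  have q1 : |(q.1 : ℝ)| ≤ q.2 := by exact_mod_cast hq1
  have p2 : (1 : ℝ) ≤ p.2 := by exact_mod_cast hp2
  have q2 : (1 : ℝ) ≤ q.2 := by exact_mod_cast hq2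
  have hS : 2 ≤ (q.2 : ℝ) + p.2 := by linarith
  have h1 : |b * (((q.2 : ℝ) - p.2) * (q.2 + p.2)) + a * ((q.1 - p.1) * (q.1 + p.1))| ≤ 2 := by
    rw [abs_le]
    constructor <;> nlinarith [hp.1, hp.2, hq.1, hq.2]
  have h2 : |a * (((q.1 : ℝ) - p.1) * (q.1 + p.1))| ≤ a * (L * (q.2 + p.2)) := by
    rw [abs_mul, abs_mul, abs_of_pos (by linarith [ha.1] : 0 < a)]
    have : |(q.1 : ℝ) + p.1| ≤ q.2 + p.2 := (abs_add_le _ _).trans (add_le_add q1 p1)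
    have hL0 := (abs_nonneg _).trans hL
    have ha0 : 0 ≤ a := by linarith [ha.1]
    gcongr
  have h3 : b * (|(q.2 : ℝ) - p.2| * (q.2 + p.2)) ≤ a * (L * (q.2 + p.2)) + 2 := by
    have : |b * (((q.2 : ℝ) - p.2) * (q.2 + p.2))| = b * (|(q.2 : ℝ) - p.2| * (q.2 + p.2)) := by
      rw [abs_mul, abs_mul, abs_of_pos (by linarith : 0 < b),
        abs_of_pos (by linarith : 0 < (q.2 : ℝ) + p.2)]
    rw [← this]
    have := abs_sub_abs_le_abs_sub (b * (((q.2 : ℝ) - p.2) * (q.2 + p.2)))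
      (-(a * (((q.1 : ℝ) - p.1) * (q.1 + p.1))))
    rw [abs_neg, sub_neg_eq_add] at this
    linarith
  have hL0 := (abs_nonneg _).trans hL
  by_contra hcon
  push Not at hcon
  have h4 : 9 * (18 * L + 1) * (q.2 + p.2) < b * (|(q.2 : ℝ) - p.2| * (q.2 + p.2)) := by
    rw [← mul_assoc]
    refine mul_lt_mul_of_pos_right ?_ (by linarith)
    nlinarith
  have h5 : a * (L * (q.2 + p.2)) ≤ 160 * (L * (q.2 + p.2 : ℝ)) :=
    mul_le_mul_of_nonneg_right ha.2 (by positivity)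
  nlinarith [mul_nonneg hL0 (by linarith : (0 : ℝ) ≤ (q.2 : ℝ) + p.2)]

/-- Eliminating `x` from the two increments of the form expresses `2 b y` times the determinant by
terms of size `O(l³)`. As `y ≥ 400 l³`, the determinant is an integer of absolute value below 1. -/
theorem det_eq_zero_of_close {a b c : ℝ} (ha : 9 ≤ a ∧ a ≤ 160) (hb : 9 ≤ b) {l R : ℕ}
    (hlR : 400 * l ^ 3 ≤ R) {p q r : ℤ × ℤ}
    (hp : InAnnulus a b c p) (hq : InAnnulus a b c q) (hr : InAnnulus a b c r)
    (hp1 : |p.1| ≤ p.2) (hq1 : |q.1| ≤ q.2) (hr1 : |r.1| ≤ r.2)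
    (hp2 : 1 ≤ p.2) (hq2 : 1 ≤ q.2) (hr2 : 1 ≤ r.2) (hR : (R : ℤ) ≤ p.2)
    (hpq : |q.1 - p.1| ≤ l) (hpr : |r.1 - p.1| ≤ l) :
    (q.1 - p.1) * (r.2 - p.2) - (r.1 - p.1) * (q.2 - p.2) = 0 := by
  rcases Nat.eq_zero_or_pos l with rfl | hl
  · have h1 : q.1 - p.1 = 0 := abs_nonpos_iff.1 (by exact_mod_cast hpq)
    have h2 : r.1 - p.1 = 0 := abs_nonpos_iff.1 (by exact_mod_cast hpr)
    rw [h1, h2]; ring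
  have hl1 : (1 : ℝ) ≤ l := by exact_mod_cast hl
  have hX : |(q.1 : ℝ) - p.1| ≤ l := by exact_mod_cast hpq
  have hZ : |(r.1 : ℝ) - p.1| ≤ l := by exact_mod_cast hpr
  have hY := abs_sub_snd_le ha hb hp hq hp1 hq1 hp2 hq2 hX
  have hW := abs_sub_snd_le ha hb hp hr hp1 hr1 hp2 hr2 hZ
  have hy : 400 * (l : ℝ) ^ 3 ≤ p.2 := by
    have : ((400 * l ^ 3 : ℕ) : ℤ) ≤ p.2 := le_trans (by exact_mod_cast hlR) hR
    exact_mod_cast this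
  set x : ℝ := ((p.1 : ℤ) : ℝ)
  set y : ℝ := ((p.2 : ℤ) : ℝ)
  obtain ⟨X, hXd⟩ : ∃ X : ℝ, X = q.1 - x := ⟨_, rfl⟩
  obtain ⟨Y, hYd⟩ : ∃ Y : ℝ, Y = q.2 - y := ⟨_, rfl⟩
  obtain ⟨Z, hZd⟩ : ∃ Z : ℝ, Z = r.1 - x := ⟨_, rfl⟩
  obtain ⟨W, hWd⟩ : ∃ W : ℝ, W = r.2 - y := ⟨_, rfl⟩
  obtain ⟨hq3, hq4⟩ := hq
  obtain ⟨hr3, hr4⟩ := hr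
  obtain ⟨hp3, hp4⟩ := hp
  rw [show (q.1 : ℝ) = x + X by rw [hXd]; ring, show (q.2 : ℝ) = y + Y by rw [hYd]; ring]
    at hq3 hq4
  rw [show (r.1 : ℝ) = x + Z by rw [hZd]; ring, show (r.2 : ℝ) = y + W by rw [hWd]; ring]
    at hr3 hr4
  rw [← hXd] at hX
  rw [← hYd] at hY
  rw [← hZd] at hZ
  rw [← hWd] at hW
  have hY' : |Y| ≤ 19 * l := by linarith
  have hW' : |W| ≤ 19 * l := by linarith
  obtain ⟨δ, hδ⟩ : ∃ δ : ℝ, δ = a * (x + X) ^ 2 + b * (y + Y) ^ 2 - (a * x ^ 2 + b * y ^ 2) :=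
    ⟨_, rfl⟩
  obtain ⟨η, hη⟩ : ∃ η : ℝ, η = a * (x + Z) ^ 2 + b * (y + W) ^ 2 - (a * x ^ 2 + b * y ^ 2) :=
    ⟨_, rfl⟩
  have hδ2 : |δ| ≤ 2 := by rw [hδ, abs_le]; constructor <;> linarith
  have hη2 : |η| ≤ 2 := by rw [hη, abs_le]; constructor <;> linarith
  have key : 2 * b * y * (X * W - Z * Y) =
      b * (Y ^ 2 * Z - W ^ 2 * X) + a * (X * Z * (X - Z)) - (δ * Z - η * X) := by
    rw [hδ, hη]; ring
  have hl0 : (0 : ℝ) ≤ l := by linarith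
  have t1 : |Y ^ 2 * Z| ≤ (19 * l) ^ 2 * l := by
    rw [abs_mul, abs_pow]; gcongr
  have t2 : |W ^ 2 * X| ≤ (19 * l) ^ 2 * l := by
    rw [abs_mul, abs_pow]; gcongr
  have t3 : |X * Z * (X - Z)| ≤ l * l * (l + l) := by
    rw [abs_mul, abs_mul]
    have := abs_sub X Z
    gcongr
    linarith
  have t4 : |δ * Z| ≤ 2 * l := by rw [abs_mul]; gcongr
  have t5 : |η * X| ≤ 2 * l := by rw [abs_mul]; gcongr
  have hbound : |2 * b * y * (X * W - Z * Y)| ≤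
      b * (2 * (361 * (l : ℝ) ^ 3)) + a * (2 * (l : ℝ) ^ 3) + 4 * l := by
    have s1 : |b * (Y ^ 2 * Z - W ^ 2 * X)| ≤ b * (2 * (361 * (l : ℝ) ^ 3)) := by
      rw [abs_mul, abs_of_pos (by linarith : 0 < b)]
      have := abs_sub (Y ^ 2 * Z) (W ^ 2 * X)
      exact mul_le_mul_of_nonneg_left (by linarith) (by linarith)
    have s2 : |a * (X * Z * (X - Z))| ≤ a * (2 * (l : ℝ) ^ 3) := by
      rw [abs_mul, abs_of_pos (by linarith [ha.1] : 0 < a)]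
      exact mul_le_mul_of_nonneg_left (by linarith) (by linarith [ha.1])
    have s3 := abs_sub (δ * Z) (η * X)
    have s4 := abs_sub (b * (Y ^ 2 * Z - W ^ 2 * X) + a * (X * Z * (X - Z))) (δ * Z - η * X)
    have s5 := abs_add_le (b * (Y ^ 2 * Z - W ^ 2 * X)) (a * (X * Z * (X - Z)))
    rw [key]
    linarith
  have hl3 : (l : ℝ) ≤ (l : ℝ) ^ 3 := le_self_pow₀ hl1 (by norm_num)
  have hl3' : (1 : ℝ) ≤ (l : ℝ) ^ 3 := hl1.trans hl3
  -- The constant 400 is large enough because `800 b > 722 b + 2 a + 4` for `b ≥ 9` and `a ≤ 160`.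
  have hD : |X * W - Z * Y| < 1 := by
    by_contra hcon
    push Not at hcon
    have hy0 : 0 < y := by linarith
    rw [abs_mul, abs_of_pos (by positivity : 0 < 2 * b * y)] at hbound
    have u1 : 2 * b * y ≤ 2 * b * y * |X * W - Z * Y| :=
      le_mul_of_one_le_right (by positivity) hcon
    have u2 : 2 * b * (400 * (l : ℝ) ^ 3) ≤ 2 * b * y := by gcongr
    have u3 : a * (2 * (l : ℝ) ^ 3) ≤ 160 * (2 * (l : ℝ) ^ 3) := by gcongr; exact ha.2
    have u4 : 9 * (l : ℝ) ^ 3 ≤ b * (l : ℝ) ^ 3 := by gcongr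
    linarith
  have : |(q.1 - p.1) * (r.2 - p.2) - (r.1 - p.1) * (q.2 - p.2)| < 1 := by
    have : |(((q.1 - p.1) * (r.2 - p.2) - (r.1 - p.1) * (q.2 - p.2) : ℤ) : ℝ)| < 1 := by
      push_cast
      rw [hXd, hYd, hZd, hWd] at hD
      exact hD
    exact_mod_cast this
  exact Int.abs_lt_one_iff.1 this

open Classical in
/-- The lattice points of an elliptic annulus in the sector `|x| ≤ y`, `1 ≤ y ≤ M`. -/
def upperSector (a b : ℝ) (M : ℕ) (c : ℝ) : Finset (ℤ × ℤ) :=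
  (symIcc M ×ˢ symIcc M).filter fun p => |p.1| ≤ p.2 ∧ 1 ≤ p.2 ∧ InAnnulus a b c p

theorem mem_upperSector {a b c : ℝ} {M : ℕ} {p : ℤ × ℤ} :
    p ∈ upperSector a b M c ↔ (p.1 ∈ symIcc M ∧ p.2 ∈ symIcc M) ∧ |p.1| ≤ p.2 ∧ 1 ≤ p.2 ∧
      InAnnulus a b c p := by
  simp only [upperSector, Finset.mem_filter, Finset.mem_product]

/-- With `R` the least ordinate that occurs, all ordinates lie in `[R, 5R]`. Vertical strips of
width about `R^{1/3}` contain at most two points each, since a third would be both collinear and not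
collinear with them. There are `O(R^{2/3})` strips. -/
theorem card_upperSector_le {a b : ℝ} (ha : 9 ≤ a ∧ a ≤ 160) (hb : 9 ≤ b) {M : ℕ}
    (hM : 1 ≤ M) (c : ℝ) : ((upperSector a b M c).card : ℝ) ≤ 164 * (M : ℝ) ^ (2 / 3 : ℝ) := by
  classical
  rcases (upperSector a b M c).eq_empty_or_nonempty with he | hne
  · rw [he]; simp only [Finset.card_empty, Nat.cast_zero]; positivity
  obtain ⟨m, hm, hmin⟩ := Finset.exists_min_image _ (fun p : ℤ × ℤ => p.2) hne
  rw [mem_upperSector] at hm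
  obtain ⟨hmM, hm1, hm2, hm3⟩ := hm
  obtain ⟨R, hR⟩ : ∃ R : ℕ, m.2 = R := ⟨m.2.toNat, by omega⟩
  have hR1 : 1 ≤ R := by omega
  have hRM : R ≤ M := by
    have := (Finset.mem_Icc.1 hmM.2).2
    omega
  have hR1' : (1 : ℝ) ≤ R := by exact_mod_cast hR1
  set l : ℕ := ⌊((R : ℝ) / 400) ^ (1 / 3 : ℝ)⌋₊ with hl
  have hroot : (((R : ℝ) / 400) ^ (1 / 3 : ℝ)) ^ 3 = (R : ℝ) / 400 := by
    rw [← Real.rpow_natCast, ← Real.rpow_mul (by positivity)]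
    norm_num
  have hl3 : 400 * l ^ 3 ≤ R := by
    have h1 : (l : ℝ) ≤ ((R : ℝ) / 400) ^ (1 / 3 : ℝ) := Nat.floor_le (by positivity)
    have h2 : (l : ℝ) ^ 3 ≤ (R : ℝ) / 400 := by rw [← hroot]; gcongr
    have h3 : 400 * (l : ℝ) ^ 3 ≤ R := by linarith
    exact_mod_cast h3
  -- A strip holds `l + 1` consecutive abscissas, so two of its points differ by at most `l`. The
  -- factor 8 in `hLR` comes from `400 ≤ 8³`.
  set L : ℕ := l + 1 with hL
  have hLR : (R : ℝ) ^ (1 / 3 : ℝ) ≤ 8 * L := by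
    have h1 : ((R : ℝ) / 400) ^ (1 / 3 : ℝ) < L := by
      rw [hL]; push_cast; exact Nat.lt_floor_add_one _
    refine le_of_pow_le_pow_left₀ (n := 3) (by norm_num) (by positivity) ?_
    have h2 : (R : ℝ) / 400 ≤ (L : ℝ) ^ 3 := by rw [← hroot]; gcongr
    have h3 : ((R : ℝ) ^ (1 / 3 : ℝ)) ^ 3 = R := by
      rw [← Real.rpow_natCast, ← Real.rpow_mul (by positivity)]
      norm_num
    rw [h3, mul_pow]
    linarith
  have hL0 : (0 : ℤ) < L := by positivity
  have hfib : ∀ k ∈ (upperSector a b M c).image (fun p => p.1 / (L : ℤ)),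
      ((upperSector a b M c).filter fun p => p.1 / (L : ℤ) = k).card ≤ 2 := by
    intro k _
    by_contra hcon
    push Not at hcon
    obtain ⟨p, hp, q, hq, r, hr, hpq, hpr, hqr⟩ := Finset.two_lt_card.1 hcon
    have hmp := hmin p (Finset.mem_filter.1 hp).1
    simp only [Finset.mem_filter, mem_upperSector] at hp hq hr
    have hclose : ∀ s t : ℤ, s / (L : ℤ) = k → t / (L : ℤ) = k → |s - t| ≤ l := by
      intro s t hs ht
      have e1 := Int.mul_ediv_add_emod s L
      have e2 := Int.mul_ediv_add_emod t L
      have e3 := Int.emod_nonneg s hL0.ne'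
      have e4 := Int.emod_nonneg t hL0.ne'
      have e5 := Int.emod_lt_of_pos s hL0
      have e6 := Int.emod_lt_of_pos t hL0
      rw [hs] at e1
      rw [ht] at e2
      rw [abs_le]
      constructor <;> omega
    exact det_ne_zero_of_inAnnulus ha.1 hb hp.1.2.2.2 hq.1.2.2.2 hr.1.2.2.2 hpq hpr hqr
      (det_eq_zero_of_close ha hb hl3 hp.1.2.2.2 hq.1.2.2.2 hr.1.2.2.2 hp.1.2.1 hq.1.2.1
        hr.1.2.1 hp.1.2.2.1 hq.1.2.2.1 hr.1.2.2.1 (by rw [← hR]; exact hmp)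
        (hclose _ _ hq.2 hp.2) (hclose _ _ hr.2 hp.2))
  have hcard := Finset.card_le_mul_card_image (upperSector a b M c) 2 hfib
  have himage : (upperSector a b M c).image (fun p => p.1 / (L : ℤ)) ⊆
      Finset.Icc (-(5 * R : ℤ) / L) ((5 * R : ℤ) / L) := by
    intro k hk
    obtain ⟨p, hp, rfl⟩ := Finset.mem_image.1 hk
    rw [mem_upperSector] at hp
    obtain ⟨-, hp1, hp2, hp3⟩ := hp
    have hpR : p.2 ≤ 5 * R := by
      have hm1' : |(m.1 : ℝ)| ≤ R := by rw [hR] at hm1; exact_mod_cast hm1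
      have hx : (m.1 : ℝ) ^ 2 ≤ (R : ℝ) ^ 2 := sq_le_sq' (by linarith [neg_abs_le (m.1 : ℝ)])
        ((le_abs_self _).trans hm1')
      have h1 := hm3.1
      have h2 := hp3.2
      rw [hR] at h1
      push_cast at h1
      have h3 : a * (m.1 : ℝ) ^ 2 ≤ 160 * (R : ℝ) ^ 2 :=
        mul_le_mul ha.2 hx (by positivity) (by norm_num)
      have h4 : 0 ≤ a * (p.1 : ℝ) ^ 2 := by have := ha.1; positivity
      -- `b p₂² < (160 + b) R² + 2 ≤ 25 b R²`, because `24 b ≥ 216` and `R ≥ 1`.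
      have h5 : b * (p.2 : ℝ) ^ 2 < b * (5 * R : ℝ) ^ 2 := by nlinarith
      have h6 : (p.2 : ℝ) ^ 2 < (5 * R : ℝ) ^ 2 := lt_of_mul_lt_mul_left h5 (by linarith)
      have h7 : (p.2 : ℝ) < 5 * R := lt_of_pow_lt_pow_left₀ 2 (by positivity) h6
      exact_mod_cast h7.le
    rw [abs_le] at hp1
    exact Finset.mem_Icc.2 ⟨Int.ediv_le_ediv hL0 (by linarith), Int.ediv_le_ediv hL0 (by linarith)⟩
  have hcells : (((upperSector a b M c).image (fun p => p.1 / (L : ℤ))).card : ℝ) ≤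
      10 * R / L + 2 := by
    have h1 := Finset.card_le_card himage
    rw [Int.card_Icc] at h1
    have h2 : (-(5 * R : ℤ) / L) * L ≥ -(5 * R : ℤ) - L + 1 := by
      have e1 := Int.mul_ediv_add_emod (-(5 * R : ℤ)) L
      have e2 := Int.emod_lt_of_pos (-(5 * R : ℤ)) hL0
      linarith
    have h3 : ((5 * R : ℤ) / L) * L ≤ 5 * R := Int.ediv_mul_le _ hL0.ne'
    have h4 : (-(5 * R : ℤ) / L) ≤ (5 * R : ℤ) / L := Int.ediv_le_ediv hL0 (by linarith)
    have h5 : (((5 * R : ℤ) / L + 1 - -(5 * R : ℤ) / L).toNat : ℤ) =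
        (5 * R : ℤ) / L + 1 - -(5 * R : ℤ) / L := Int.toNat_of_nonneg (by linarith)
    have h6 : (((upperSector a b M c).image (fun p => p.1 / (L : ℤ))).card : ℤ) * L ≤
        10 * R + 2 * L := by
      have : (((upperSector a b M c).image (fun p => p.1 / (L : ℤ))).card : ℤ) ≤
        (5 * R : ℤ) / L + 1 - -(5 * R : ℤ) / L := by rw [← h5]; exact_mod_cast h1
      nlinarith
    have hL0' : (0 : ℝ) < L := by exact_mod_cast hL0
    have h7 : (((upperSector a b M c).image (fun p => p.1 / (L : ℤ))).card : ℝ) * L ≤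
        10 * R + 2 * L := by exact_mod_cast h6
    calc _ ≤ (10 * (R : ℝ) + 2 * L) / L := (le_div_iff₀ hL0').2 h7
      _ = _ := by field_simp
  have hL0' : (0 : ℝ) < L := by exact_mod_cast hL0
  have hsplit : (R : ℝ) = (R : ℝ) ^ (2 / 3 : ℝ) * (R : ℝ) ^ (1 / 3 : ℝ) := by
    rw [← Real.rpow_add (by positivity)]; norm_num
  have hRL : (R : ℝ) / L ≤ 8 * (R : ℝ) ^ (2 / 3 : ℝ) := by
    rw [div_le_iff₀ hL0']
    calc (R : ℝ) = (R : ℝ) ^ (2 / 3 : ℝ) * (R : ℝ) ^ (1 / 3 : ℝ) := hsplit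
      _ ≤ (R : ℝ) ^ (2 / 3 : ℝ) * (8 * L) := by gcongr
      _ = _ := by ring
  have hR23 : (1 : ℝ) ≤ (R : ℝ) ^ (2 / 3 : ℝ) := Real.one_le_rpow hR1' (by norm_num)
  have hRM' : (R : ℝ) ^ (2 / 3 : ℝ) ≤ (M : ℝ) ^ (2 / 3 : ℝ) := by gcongr
  calc ((upperSector a b M c).card : ℝ)
      ≤ 2 * (((upperSector a b M c).image (fun p => p.1 / (L : ℤ))).card : ℝ) := by
        exact_mod_cast hcard
    _ ≤ 164 * (M : ℝ) ^ (2 / 3 : ℝ) := by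
        rw [mul_div_assoc] at hcells
        linarith

theorem shellBound_two : ShellBound 2 (2 / 3) := by
  classical
  -- `657 = 1 + 4 · 164`: the origin, and four sectors reduced to the upper one by reflection and by
  -- exchanging the coordinates.
  refine ⟨657, by norm_num, fun θ hθ M hM c => ?_⟩
  set G := upperSector (θ 0) (θ 1) M c with hG
  set H := upperSector (θ 1) (θ 0) M c with hH
  have hGc := card_upperSector_le (hθ 0) (hθ 1).1 hM c
  have hHc := card_upperSector_le (hθ 1) (hθ 0).1 hM c
  have hsub : shell θ M c ⊆ {![0, 0]} ∪ G.image (fun p => ![p.1, p.2]) ∪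
      G.image (fun p => ![p.1, -p.2]) ∪ H.image (fun p => ![p.2, p.1]) ∪
      H.image (fun p => ![-p.2, p.1]) := by
    intro m hm
    simp only [shell, symIcc, Finset.mem_filter, Fintype.mem_piFinset, Fin.sum_univ_two,
      Finset.mem_Icc] at hm
    obtain ⟨hmM, hm1, hm2⟩ := hm
    have hm0 := hmM 0
    have hm1' := hmM 1
    have hmv : ∀ x y : ℤ, x = m 0 → y = m 1 → ![x, y] = m := by
      rintro x y rfl rfl
      ext j; fin_cases j <;> rfl
    simp only [Finset.mem_union, Finset.mem_image, Finset.mem_singleton]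
    by_cases h0 : m 0 = 0 ∧ m 1 = 0
    · exact Or.inl (Or.inl (Or.inl (Or.inl (hmv _ _ h0.1.symm h0.2.symm).symm)))
    rcases le_total |m 0| |m 1| with h | h
    · have h1 : 1 ≤ |m 1| := by
        by_contra hc
        have : |m 1| = 0 := by have := abs_nonneg (m 1); omega
        rw [this] at h
        exact h0 ⟨abs_nonpos_iff.1 h, abs_eq_zero.1 this⟩
      have hmem : ((m 0, |m 1|) : ℤ × ℤ) ∈ G := by
        rw [hG, mem_upperSector]
        simp only [symIcc, Finset.mem_Icc, InAnnulus, Int.cast_abs, sq_abs]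
        exact ⟨⟨hm0, by linarith, abs_le.2 hm1'⟩, h, h1, hm1, hm2⟩
      rcases abs_choice (m 1) with hc | hc
      · exact Or.inl (Or.inl (Or.inl (Or.inr ⟨_, hmem, hmv _ _ rfl hc⟩)))
      · exact Or.inl (Or.inl (Or.inr ⟨_, hmem, hmv _ _ rfl (by simp [hc])⟩))
    · have h1 : 1 ≤ |m 0| := by
        by_contra hc
        have : |m 0| = 0 := by have := abs_nonneg (m 0); omega
        rw [this] at h
        exact h0 ⟨abs_eq_zero.1 this, abs_nonpos_iff.1 h⟩
      have hmem : ((m 1, |m 0|) : ℤ × ℤ) ∈ H := by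
        rw [hH, mem_upperSector]
        simp only [symIcc, Finset.mem_Icc, InAnnulus, Int.cast_abs, sq_abs]
        exact ⟨⟨hm1', by linarith, abs_le.2 hm0⟩, h, h1, by linarith, by linarith⟩
      rcases abs_choice (m 0) with hc | hc
      · exact Or.inl (Or.inr ⟨_, hmem, hmv _ _ hc rfl⟩)
      · exact Or.inr ⟨_, hmem, hmv _ _ (by simp [hc]) rfl⟩
  have hcard : (shell θ M c).card ≤ 1 + G.card + G.card + H.card + H.card := by
    refine (Finset.card_le_card hsub).trans ?_
    refine (Finset.card_union_le _ _).trans (Nat.add_le_add ?_ Finset.card_image_le)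
    refine (Finset.card_union_le _ _).trans (Nat.add_le_add ?_ Finset.card_image_le)
    refine (Finset.card_union_le _ _).trans (Nat.add_le_add ?_ Finset.card_image_le)
    refine (Finset.card_union_le _ _).trans (Nat.add_le_add ?_ Finset.card_image_le)
    exact (Finset.card_singleton _).le
  have hcard' : ((shell θ M c).card : ℝ) ≤ 1 + G.card + G.card + H.card + H.card := by
    exact_mod_cast hcard
  have hM1 : (1 : ℝ) ≤ (M : ℝ) ^ (2 / 3 : ℝ) :=
    Real.one_le_rpow (by exact_mod_cast hM) (by norm_num)
  linarith

end EllipticAnnulus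

/-! ### Orthogonality of the characters and Bessel's inequality -/

section Characters

theorem integral_fourier {T : ℝ} [hT : Fact (0 < T)] (n : ℤ) :
    ∫ x : AddCircle T, fourier n x = if n = 0 then (T : ℂ) else 0 := by
  have h := congrFun (fourierCoeff_fourier (T := T) n) 0
  rw [fourierCoeff] at h
  simp only [neg_zero, fourier_zero, one_smul] at h
  rw [AddCircle.integral_haarAddCircle] at h
  have h2 : ∫ x : AddCircle T, fourier n x = T • (T⁻¹ • ∫ x : AddCircle T, fourier n x) := by
    rw [smul_inv_smul₀ hT.out.ne']
  rw [h2, h]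
  by_cases hn : n = 0
  · subst hn; simp
  · simp [hn, Ne.symm hn]

variable {d : ℕ} {α : Fin d → ℝ}

theorem character_apply (n : Fin d → ℤ) (x : Torus α) :
    character α n x = ∏ j, fourier (n j) (x j) := rfl

theorem character_add (n m : Fin d → ℤ) (x : Torus α) :
    character α (n + m) x = character α n x * character α m x := by
  simp only [character_apply, Pi.add_apply, fourier_add, Finset.prod_mul_distrib]

theorem character_neg (n : Fin d → ℤ) (x : Torus α) :
    character α (-n) x = (starRingEnd ℂ) (character α n x) := by
  simp only [character_apply, Pi.neg_apply, fourier_neg, map_prod]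

variable [∀ j, Fact (0 < α j)]

theorem integral_character (n : Fin d → ℤ) :
    ∫ x : Torus α, character α n x = if n = 0 then ((∏ j, α j : ℝ) : ℂ) else 0 := by
  simp only [character_apply]
  rw [integral_fintype_prod_volume_eq_prod (fun j (x : AddCircle (α j)) => fourier (n j) x)]
  simp only [integral_fourier]
  split_ifs with h
  · subst h; simp
  · obtain ⟨i, hi⟩ := Function.ne_iff.mp h
    exact Finset.prod_eq_zero (Finset.mem_univ i) (if_neg hi)

theorem integral_character_mul_conj (n m : Fin d → ℤ) :
    ∫ x : Torus α, character α n x * (starRingEnd ℂ) (character α m x) =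
      if n = m then ((∏ j, α j : ℝ) : ℂ) else 0 := by
  simp only [← character_neg, ← character_add, integral_character, ← sub_eq_add_neg, sub_eq_zero]

theorem prod_period_pos : 0 < ∏ j, α j :=
  Finset.prod_pos fun j _ => (inferInstance : Fact (0 < α j)).out

theorem coeFn_characterLp (n : Fin d → ℤ) :
    characterLp α n =ᵐ[volume] character α n :=
  ContinuousMap.coeFn_toLp _ _

theorem inner_characterLp (n : Fin d → ℤ) (f : Lp ℂ 2 (volume : Measure (Torus α))) :
    inner ℂ (characterLp α n) f = ((∏ j, α j : ℝ) : ℂ) * fourierCoefficient f n := by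
  have hV : ((∏ j, α j : ℝ) : ℂ) ≠ 0 := by exact_mod_cast (prod_period_pos (α := α)).ne'
  rw [fourierCoefficient, mul_inv_cancel_left₀ hV, L2.inner_def]
  refine integral_congr_ae ?_
  filter_upwards [coeFn_characterLp (α := α) n] with x hx
  rw [hx, RCLike.inner_apply, mul_comm]

theorem inner_characterLp_characterLp (n m : Fin d → ℤ) :
    inner ℂ (characterLp α n) (characterLp α m) =
      if n = m then ((∏ j, α j : ℝ) : ℂ) else 0 := by
  rw [characterLp, characterLp, ContinuousMap.inner_toLp]
  simp only [integral_character_mul_conj, eq_comm]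

/-- Bessel's inequality for the characters of the torus. -/
theorem sum_norm_fourierCoefficient_sq_le (f : Lp ℂ 2 (volume : Measure (Torus α)))
    (S : Finset (Fin d → ℤ)) :
    (∏ j, α j) * ∑ n ∈ S, ‖fourierCoefficient f n‖ ^ 2 ≤ ‖f‖ ^ 2 := by
  set V := ∏ j, α j with hVdef
  have hV : 0 < V := prod_period_pos
  set r : ℂ := (((Real.sqrt V)⁻¹ : ℝ) : ℂ) with hr
  have hsq : (Real.sqrt V)⁻¹ * (Real.sqrt V)⁻¹ * V = 1 := by
    rw [← mul_inv, Real.mul_self_sqrt hV.le, inv_mul_cancel₀ hV.ne']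
  have hrV : r * (r * (V : ℂ)) = 1 := by
    rw [← mul_assoc, hr]; exact_mod_cast hsq
  have hon : Orthonormal ℂ (fun n : Fin d → ℤ => r • characterLp α n) := by
    rw [orthonormal_iff_ite]
    intro n m
    rw [inner_smul_left, inner_smul_right, inner_characterLp_characterLp, hr, Complex.conj_ofReal,
      ← hr]
    split_ifs
    · exact hrV
    · simp
  refine le_trans (le_of_eq ?_) (hon.sum_inner_products_le f (s := S))
  rw [Finset.mul_sum]
  refine Finset.sum_congr rfl fun n _ => ?_
  rw [inner_smul_left, inner_characterLp, norm_mul, norm_mul, hr, Complex.conj_ofReal,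
    Complex.norm_real, Complex.norm_real, Real.norm_of_nonneg (by positivity),
    Real.norm_of_nonneg hV.le, mul_pow, mul_pow, ← mul_assoc]
  congr 1
  linear_combination -V * hsq

variable {ι : Type*}

theorem integral_norm_sum_character_sq (P : Finset ι) (φ : ι → Fin d → ℤ) (b : ι → ℂ) :
    ((∫ x : Torus α, ‖∑ p ∈ P, b p * character α (φ p) x‖ ^ 2 : ℝ) : ℂ) =
      ∑ p ∈ P, ∑ q ∈ P, b p * (starRingEnd ℂ) (b q) *
        (if φ p = φ q then ((∏ j, α j : ℝ) : ℂ) else 0) := by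
  rw [← integral_complex_ofReal]
  have h : ∀ x : Torus α, ((‖∑ p ∈ P, b p * character α (φ p) x‖ ^ 2 : ℝ) : ℂ) =
      ∑ p ∈ P, ∑ q ∈ P, b p * (starRingEnd ℂ) (b q) *
        (character α (φ p) x * (starRingEnd ℂ) (character α (φ q) x)) := by
    intro x
    rw [Complex.ofReal_pow, ← Complex.mul_conj', map_sum, Finset.sum_mul_sum]
    refine Finset.sum_congr rfl fun p _ => Finset.sum_congr rfl fun q _ => ?_
    rw [map_mul]; ring
  have hint : ∀ p q, Integrable (fun x : Torus α => b p * (starRingEnd ℂ) (b q) *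
      (character α (φ p) x * (starRingEnd ℂ) (character α (φ q) x))) := by
    intro p q
    refine Continuous.integrable_of_hasCompactSupport ?_ (HasCompactSupport.of_compactSpace _)
    have h1 := (character α (φ p)).continuous
    have h2 := (character α (φ q)).continuous
    fun_prop
  simp_rw [h]
  rw [integral_finsetSum _ (fun p _ => integrable_finsetSum _ fun q _ => hint p q)]
  refine Finset.sum_congr rfl fun p _ => ?_
  rw [integral_finsetSum _ (fun q _ => hint p q)]
  refine Finset.sum_congr rfl fun q _ => ?_
  rw [integral_const_mul, integral_character_mul_conj]

end Characters

/-! ### Space-time `L²` bound with a Gaussian weight in time -/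

section GaussianWeight

theorem integral_exp_mul_gaussian {β : ℝ} (hβ : 0 < β) (ω : ℝ) :
    ∫ t : ℝ, Complex.exp (-Complex.I * t * ω) * (Real.exp (-β * t ^ 2) : ℂ) =
      ((Real.sqrt (Real.pi / β) * Real.exp (-ω ^ 2 / (4 * β)) : ℝ) : ℂ) := by
  have h := fourierIntegral_gaussian (b := (β : ℂ)) (by simpa using hβ) (-(ω : ℂ))
  have h1 : ((Real.pi : ℂ) / β) ^ (1 / 2 : ℂ) = (Real.sqrt (Real.pi / β) : ℂ) := by
    rw [Real.sqrt_eq_rpow, Complex.ofReal_cpow (by positivity)]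
    push_cast
    rfl
  rw [h1] at h
  push_cast
  rw [show -(ω : ℂ) ^ 2 / (4 * β) = -(-(ω : ℂ)) ^ 2 / (4 * β) by ring, ← h]
  refine integral_congr_ae (Filter.Eventually.of_forall fun t => ?_)
  simp only
  congr 2
  ring

theorem integrable_exp_mul_gaussian {β : ℝ} (hβ : 0 < β) (ω : ℝ) :
    Integrable fun t : ℝ => Complex.exp (-Complex.I * t * ω) * (Real.exp (-β * t ^ 2) : ℂ) := by
  refine (integrable_exp_neg_mul_sq hβ).mono' (by fun_prop) ?_
  filter_upwards with t
  rw [norm_mul, Complex.norm_real, Real.norm_of_nonneg (Real.exp_pos _).le,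
    show -Complex.I * t * ω = ((-(t * ω) : ℝ) : ℂ) * Complex.I by push_cast; ring,
    Complex.norm_exp_ofReal_mul_I, one_mul]

theorem summable_inv_one_add_sq : Summable fun k : ℤ => (1 + (k : ℝ) ^ 2)⁻¹ := by
  have h1 : Summable fun k : ℤ => (1 : ℝ) / (k : ℝ) ^ 2 :=
    Real.summable_one_div_int_pow.2 one_lt_two
  have h2 : Summable fun k : ℤ => if k = 0 then (1 : ℝ) else 0 := (hasSum_ite_eq 0 1).summable
  refine Summable.of_nonneg_of_le (fun k => by positivity) (fun k => ?_) (h1.add h2)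
  split_ifs with h
  · subst h; simp
  · rw [add_zero, one_div]
    have : (k : ℝ) ≠ 0 := by exact_mod_cast h
    exact inv_anti₀ (by positivity) (by linarith)

/-- A majorant constant on unit intervals and summable over them lets a Gaussian sum be bounded by
counting the points in each interval. -/
theorem exp_neg_sq_le_floor {β : ℝ} (hβ : 0 < β) (u : ℝ) :
    Real.exp (-u ^ 2 / (4 * β)) ≤ 3 * (1 + 4 * β) * (1 + (⌊u⌋ : ℝ) ^ 2)⁻¹ := by
  have h1 : 1 + u ^ 2 / (4 * β) ≤ Real.exp (u ^ 2 / (4 * β)) := by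
    linarith [Real.add_one_le_exp (u ^ 2 / (4 * β))]
  have h2 : 1 + (⌊u⌋ : ℝ) ^ 2 ≤ 3 * (1 + u ^ 2) := by
    have := Int.floor_le u
    have := Int.lt_floor_add_one u
    nlinarith [sq_nonneg (u + 1), sq_nonneg (u - (⌊u⌋ : ℝ)), sq_nonneg (u - 1),
      sq_nonneg ((⌊u⌋ : ℝ) - 2 * u), sq_nonneg ((⌊u⌋ : ℝ) + u)]
  have h3 : 1 + u ^ 2 ≤ (1 + 4 * β) * (1 + u ^ 2 / (4 * β)) := by
    have : (1 + 4 * β) * (1 + u ^ 2 / (4 * β)) = 1 + u ^ 2 + (4 * β + u ^ 2 / (4 * β)) := by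
      field_simp; ring
    rw [this]
    have : 0 ≤ 4 * β + u ^ 2 / (4 * β) := by positivity
    linarith
  rw [neg_div, Real.exp_neg, ← div_eq_mul_inv, le_div_iff₀ (by positivity),
    inv_mul_le_iff₀ (Real.exp_pos _)]
  have h4 : (1 + 4 * β) * (1 + u ^ 2 / (4 * β)) ≤ (1 + 4 * β) * Real.exp (u ^ 2 / (4 * β)) := by
    gcongr
  linarith

variable {ι : Type*}

/-- A Gaussian sum over a set with at most `B` elements in each unit interval. -/
theorem sum_exp_neg_sq_le {β B : ℝ} (hβ : 0 < β) (hB : 0 ≤ B) (P : Finset ι) (ω : ι → ℝ) (c : ℝ)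
    (hcount : ∀ y : ℝ, ((P.filter fun q => y ≤ ω q ∧ ω q < y + 1).card : ℝ) ≤ B) :
    ∑ q ∈ P, Real.exp (-(c - ω q) ^ 2 / (4 * β)) ≤
      3 * (1 + 4 * β) * B * ∑' k : ℤ, (1 + (k : ℝ) ^ 2)⁻¹ := by
  classical
  calc ∑ q ∈ P, Real.exp (-(c - ω q) ^ 2 / (4 * β))
      ≤ ∑ q ∈ P, 3 * (1 + 4 * β) * (1 + (⌊ω q - c⌋ : ℝ) ^ 2)⁻¹ := by
        refine Finset.sum_le_sum fun q _ => ?_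
        rw [show (c - ω q) ^ 2 = (ω q - c) ^ 2 by ring]
        exact exp_neg_sq_le_floor hβ _
    _ = ∑ k ∈ P.image (fun q => ⌊ω q - c⌋), ∑ q ∈ P.filter (fun q => ⌊ω q - c⌋ = k),
          3 * (1 + 4 * β) * (1 + (⌊ω q - c⌋ : ℝ) ^ 2)⁻¹ :=
        (Finset.sum_fiberwise_of_maps_to (fun q hq => Finset.mem_image_of_mem _ hq) _).symm
    _ ≤ ∑ k ∈ P.image (fun q => ⌊ω q - c⌋), 3 * (1 + 4 * β) * B * (1 + (k : ℝ) ^ 2)⁻¹ := by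
        refine Finset.sum_le_sum fun k _ => ?_
        have h1 : ∑ q ∈ P.filter (fun q => ⌊ω q - c⌋ = k),
            3 * (1 + 4 * β) * (1 + (⌊ω q - c⌋ : ℝ) ^ 2)⁻¹ =
            (P.filter (fun q => ⌊ω q - c⌋ = k)).card * (3 * (1 + 4 * β) * (1 + (k : ℝ) ^ 2)⁻¹) := by
          rw [← nsmul_eq_mul, ← Finset.sum_const]
          refine Finset.sum_congr rfl fun q hq => ?_
          rw [(Finset.mem_filter.1 hq).2]
        have h2 : ((P.filter (fun q => ⌊ω q - c⌋ = k)).card : ℝ) ≤ B := by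
          refine le_trans ?_ (hcount (k + c))
          refine Nat.cast_le.2 (Finset.card_le_card (Finset.monotone_filter_right _ ?_))
          intro q _ hq
          rw [Int.floor_eq_iff] at hq
          exact ⟨by linarith [hq.1], by linarith [hq.2]⟩
        rw [h1]
        calc _ ≤ B * (3 * (1 + 4 * β) * (1 + (k : ℝ) ^ 2)⁻¹) := by gcongr
          _ = _ := by ring
    _ = 3 * (1 + 4 * β) * B * ∑ k ∈ P.image (fun q => ⌊ω q - c⌋), (1 + (k : ℝ) ^ 2)⁻¹ := by
        rw [Finset.mul_sum]
    _ ≤ _ := by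
        gcongr
        exact summable_inv_one_add_sq.sum_le_tsum _ fun k _ => by positivity

/-- Schur's test for a symmetric nonnegative kernel on a finite set. -/
theorem sum_sum_le_of_schur (P : Finset ι) (K : ι → ι → ℝ) (b : ι → ℝ) {D : ℝ}
    (hK : ∀ p q, 0 ≤ K p q) (hsymm : ∀ p q, K p q = K q p)
    (hD : ∀ p ∈ P, ∑ q ∈ P, K p q ≤ D) :
    ∑ p ∈ P, ∑ q ∈ P, b p * b q * K p q ≤ D * ∑ p ∈ P, b p ^ 2 := by
  have h1 : ∑ p ∈ P, ∑ q ∈ P, b p * b q * K p q ≤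
      ∑ p ∈ P, ∑ q ∈ P, (b p ^ 2 * K p q / 2 + b q ^ 2 * K q p / 2) := by
    refine Finset.sum_le_sum fun p _ => Finset.sum_le_sum fun q _ => ?_
    rw [← hsymm p q]
    nlinarith [mul_nonneg (sq_nonneg (b p - b q)) (hK p q)]
  have h2 : ∑ p ∈ P, ∑ q ∈ P, (b p ^ 2 * K p q / 2 + b q ^ 2 * K q p / 2) =
      ∑ p ∈ P, b p ^ 2 * ∑ q ∈ P, K p q := by
    simp_rw [Finset.sum_add_distrib]
    rw [Finset.sum_comm (f := fun p q => b q ^ 2 * K q p / 2), ← Finset.sum_add_distrib]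
    refine Finset.sum_congr rfl fun p _ => ?_
    rw [← Finset.sum_add_distrib, Finset.mul_sum]
    exact Finset.sum_congr rfl fun q _ => by ring
  refine h1.trans (h2.le.trans ?_)
  rw [Finset.mul_sum]
  refine Finset.sum_le_sum fun p hp => ?_
  rw [mul_comm]
  exact mul_le_mul_of_nonneg_right (hD p hp) (sq_nonneg _)

variable {d : ℕ} {α : Fin d → ℝ} [∀ j, Fact (0 < α j)]

/-- `∑ₚ bₚ exp (-i t ωₚ) e_{φ p}(x)`. -/
def wave (P : Finset ι) (φ : ι → Fin d → ℤ) (ω : ι → ℝ) (b : ι → ℂ) (t : ℝ) (x : Torus α) : ℂ :=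
  ∑ p ∈ P, (b p * Complex.exp (-Complex.I * t * ω p)) * character α (φ p) x

/-- A wave whose frequencies with a given momentum number at most `B` in each unit interval is
square integrable in space-time against a Gaussian, with a constant linear in `B`. -/
theorem integral_gaussian_mul_wave_sq_le {β B : ℝ} (hβ : 0 < β) (hB : 0 ≤ B) (P : Finset ι)
    (φ : ι → Fin d → ℤ) (ω : ι → ℝ) (b : ι → ℂ)
    (hcount : ∀ k : Fin d → ℤ, ∀ y : ℝ,
      ((P.filter fun q => φ q = k ∧ y ≤ ω q ∧ ω q < y + 1).card : ℝ) ≤ B) :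
    Integrable (fun t : ℝ => Real.exp (-β * t ^ 2) * ∫ x : Torus α, ‖wave P φ ω b t x‖ ^ 2) ∧
    ∫ t : ℝ, Real.exp (-β * t ^ 2) * ∫ x : Torus α, ‖wave P φ ω b t x‖ ^ 2 ≤
      (∏ j, α j) * Real.sqrt (Real.pi / β) *
        (3 * (1 + 4 * β) * B * ∑' k : ℤ, (1 + (k : ℝ) ^ 2)⁻¹) * ∑ p ∈ P, ‖b p‖ ^ 2 := by
  classical
  set V := ∏ j, α j with hVdef
  have hV : 0 < V := prod_period_pos
  have hG : ∀ t : ℝ, ((Real.exp (-β * t ^ 2) * ∫ x : Torus α, ‖wave P φ ω b t x‖ ^ 2 : ℝ) : ℂ) =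
      ∑ p ∈ P, ∑ q ∈ P, (b p * (starRingEnd ℂ) (b q) * (if φ p = φ q then (V : ℂ) else 0)) *
        (Complex.exp (-Complex.I * t * (ω p - ω q : ℝ)) * (Real.exp (-β * t ^ 2) : ℂ)) := by
    intro t
    simp only [wave]
    rw [Complex.ofReal_mul, integral_norm_sum_character_sq, Finset.mul_sum]
    refine Finset.sum_congr rfl fun p _ => ?_
    rw [Finset.mul_sum]
    refine Finset.sum_congr rfl fun q _ => ?_
    have : Complex.exp (-Complex.I * t * (ω p - ω q : ℝ)) =
        Complex.exp (-Complex.I * t * ω p) *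
          (starRingEnd ℂ) (Complex.exp (-Complex.I * t * ω q)) := by
      rw [← Complex.exp_conj, ← Complex.exp_add]
      congr 1
      simp only [map_mul, map_neg, Complex.conj_I, Complex.conj_ofReal]
      push_cast
      ring
    rw [this, map_mul]
    ring
  have hint : ∀ p q, Integrable fun t : ℝ =>
      (b p * (starRingEnd ℂ) (b q) * (if φ p = φ q then (V : ℂ) else 0)) *
        (Complex.exp (-Complex.I * t * (ω p - ω q : ℝ)) * (Real.exp (-β * t ^ 2) : ℂ)) :=
    fun p q => (integrable_exp_mul_gaussian hβ _).const_mul _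
  have hintC : Integrable fun t : ℝ =>
      ((Real.exp (-β * t ^ 2) * ∫ x : Torus α, ‖wave P φ ω b t x‖ ^ 2 : ℝ) : ℂ) := by
    simp_rw [hG]
    exact integrable_finsetSum _ fun p _ => integrable_finsetSum _ fun q _ => hint p q
  refine ⟨by simpa only [RCLike.re_to_complex, Complex.ofReal_re] using hintC.re, ?_⟩
  -- Space integration gives the momentum condition and time integration the Fourier transform of
  -- the Gaussian. The kernel is nonnegative and symmetric, as Schur's test requires.
  set W : ι → ι → ℝ := fun p q => (if φ p = φ q then V else 0) *
    (Real.sqrt (Real.pi / β) * Real.exp (-(ω p - ω q) ^ 2 / (4 * β))) with hW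
  have hval : ((∫ t : ℝ, Real.exp (-β * t ^ 2) * ∫ x : Torus α, ‖wave P φ ω b t x‖ ^ 2 : ℝ) : ℂ) =
      ∑ p ∈ P, ∑ q ∈ P, b p * (starRingEnd ℂ) (b q) * (W p q : ℂ) := by
    rw [← integral_complex_ofReal]
    simp_rw [hG]
    rw [integral_finsetSum _ (fun p _ => integrable_finsetSum _ fun q _ => hint p q)]
    refine Finset.sum_congr rfl fun p _ => ?_
    rw [integral_finsetSum _ (fun q _ => hint p q)]
    refine Finset.sum_congr rfl fun q _ => ?_
    rw [integral_const_mul, integral_exp_mul_gaussian hβ]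
    simp only [hW]
    split_ifs <;> push_cast <;> ring
  have hWnn : ∀ p q, 0 ≤ W p q := by
    intro p q
    simp only [hW]
    split_ifs <;> positivity
  have hWsymm : ∀ p q, W p q = W q p := by
    intro p q
    simp only [hW, eq_comm (a := φ p), show (ω p - ω q) ^ 2 = (ω q - ω p) ^ 2 by ring]
  have hle : ∫ t : ℝ, Real.exp (-β * t ^ 2) * ∫ x : Torus α, ‖wave P φ ω b t x‖ ^ 2 ≤
      ∑ p ∈ P, ∑ q ∈ P, ‖b p‖ * ‖b q‖ * W p q := by
    refine (le_abs_self _).trans ?_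
    rw [← Real.norm_eq_abs, ← Complex.norm_real, hval]
    refine (norm_sum_le _ _).trans (Finset.sum_le_sum fun p _ => ?_)
    refine (norm_sum_le _ _).trans (Finset.sum_le_sum fun q _ => ?_)
    rw [norm_mul, norm_mul, RCLike.norm_conj, Complex.norm_real, Real.norm_of_nonneg (hWnn p q)]
  refine hle.trans (sum_sum_le_of_schur P W _ hWnn hWsymm fun p _ => ?_)
  have hrow : ∑ q ∈ P, W p q = V * Real.sqrt (Real.pi / β) *
      ∑ q ∈ P.filter (fun q => φ q = φ p), Real.exp (-(ω p - ω q) ^ 2 / (4 * β)) := by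
    rw [Finset.mul_sum, Finset.sum_filter]
    refine Finset.sum_congr rfl fun q _ => ?_
    simp only [hW, eq_comm (a := φ p)]
    split_ifs <;> ring
  rw [hrow]
  refine mul_le_mul_of_nonneg_left (sum_exp_neg_sq_le hβ hB _ ω _ fun y => ?_) (by positivity)
  rw [Finset.filter_filter]
  exact hcount _ _

end GaussianWeight

/-! ### From lattice point counts to the Strichartz estimate -/

section Strichartz

variable {d : ℕ} {α : Fin d → ℝ}

theorem symbolQ_eq_sum (n : Fin d → ℤ) :
    symbolQ α n = ∑ j, (2 * Real.pi / α j) ^ 2 * (n j : ℝ) ^ 2 :=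
  Finset.sum_congr rfl fun j _ => by ring

theorem symbolQ_sub (n m : Fin d → ℤ) :
    symbolQ α (n - m) = 2 * (symbolQ α n + symbolQ α m) - symbolQ α (n + m) := by
  simp only [symbolQ_eq_sum, Pi.sub_apply, Pi.add_apply]
  rw [← Finset.sum_add_distrib, Finset.mul_sum, ← Finset.sum_sub_distrib]
  refine Finset.sum_congr rfl fun j _ => ?_
  push_cast
  ring

/-- The pairs of frequencies with given sum and with the sum of their energies in a given unit
interval are at most as many as the lattice points of a shell. -/
theorem card_pairs_le_card_shell (M : ℕ) (k : Fin d → ℤ) (y : ℝ) :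
    ((((Fintype.piFinset fun _ : Fin d => symIcc M) ×ˢ
      (Fintype.piFinset fun _ : Fin d => symIcc M)).filter fun q =>
        q.1 + q.2 = k ∧ y ≤ symbolQ α q.1 + symbolQ α q.2 ∧
          symbolQ α q.1 + symbolQ α q.2 < y + 1)).card ≤
      (shell (fun j => (2 * Real.pi / α j) ^ 2) (2 * M) (2 * y - symbolQ α k)).card := by
  -- With the sum fixed, the difference determines the pair. Differences of points of the cube reach
  -- `2 * M`, and the parallelogram law doubles the unit interval to thickness 2.
  refine Finset.card_le_card_of_injOn (fun q => q.1 - q.2) ?_ ?_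
  · intro q hq
    simp only [Finset.coe_filter, Finset.mem_product, Fintype.mem_piFinset, symIcc,
      Finset.mem_Icc, Set.mem_ofPred_eq, shell, ← symbolQ_eq_sum, symbolQ_sub] at hq ⊢
    obtain ⟨⟨h1, h2⟩, rfl, h3, h4⟩ := hq
    refine ⟨fun j => ?_, by linarith, by linarith⟩
    have := h1 j
    have := h2 j
    simp only [Pi.sub_apply]
    push_cast
    omega
  · intro p hp q hq h
    simp only [Finset.coe_filter, Set.mem_ofPred_eq] at hp hq h
    have hs : p.1 + p.2 = q.1 + q.2 := hp.2.1.trans hq.2.1.symm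
    refine Prod.ext (funext fun j => ?_) (funext fun j => ?_) <;>
    · have h1 := congrFun h j
      have h2 := congrFun hs j
      simp only [Pi.sub_apply, Pi.add_apply] at h1 h2
      omega

theorem continuous_wave {ι : Type*} (P : Finset ι) (φ : ι → Fin d → ℤ) (ω : ι → ℝ) (b : ι → ℂ)
    (t : ℝ) : Continuous (wave (α := α) P φ ω b t) := by
  unfold wave
  exact continuous_finsetSum _ fun p _ => continuous_const.mul (character α (φ p)).continuous

theorem eLpNorm_four_pow_four {X ε : Type*} [MeasurableSpace X] [ENorm ε] (μ : Measure X)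
    (u : X → ε) : eLpNorm u 4 μ ^ 4 = ∫⁻ x, ‖u x‖ₑ ^ 4 ∂μ := by
  rw [eLpNorm_eq_lintegral_rpow_enorm_toReal (by norm_num) (by norm_num), ← ENNReal.rpow_natCast,
    ← ENNReal.rpow_mul]
  have h : ∀ y : ENNReal, y ^ (ENNReal.toReal 4) = y ^ 4 := by
    intro y
    rw [← ENNReal.rpow_natCast]
    norm_num
  simp_rw [h]
  norm_num

variable [∀ j, Fact (0 < α j)]

theorem schrodinger_ae_eq {f : Lp ℂ 2 (volume : Measure (Torus α))} {N : ℝ}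
    (hf : SpectrumIn f N) (t : ℝ) :
    schrodinger t f =ᵐ[volume] fun x => ∑ n ∈ Fintype.piFinset fun _ : Fin d => symIcc ⌊N⌋₊,
      (Complex.exp (-Complex.I * t * symbolQ α n) * fourierCoefficient f n) *
        character α n x := by
  set S := Fintype.piFinset fun _ : Fin d => symIcc ⌊N⌋₊ with hS
  have h0 : ∀ n ∉ S, fourierCoefficient f n = 0 := by
    intro n hn
    by_contra h
    refine hn (Fintype.mem_piFinset.2 fun j => Finset.mem_Icc.2 ?_)
    have h1 := hf n h j
    have h2 : (n j).natAbs ≤ ⌊N⌋₊ := by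
      refine Nat.le_floor ?_
      rwa [Nat.cast_natAbs, Int.cast_abs]
    omega
  have h1 : schrodinger t f = ContinuousMap.toLp (E := ℂ) 2 (volume : Measure (Torus α)) ℂ
      (∑ n ∈ S, (Complex.exp (-Complex.I * t * symbolQ α n) * fourierCoefficient f n) •
        character α n) := by
    rw [schrodinger, tsum_eq_sum (s := S) (fun n hn => by rw [h0 n hn, mul_zero, zero_smul]),
      map_sum]
    refine Finset.sum_congr rfl fun n _ => ?_
    rw [map_smul, characterLp]
  rw [h1]
  filter_upwards [ContinuousMap.coeFn_toLp (𝕜 := ℂ) (p := 2) (volume : Measure (Torus α))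
    (∑ n ∈ S, (Complex.exp (-Complex.I * t * symbolQ α n) * fourierCoefficient f n) •
        character α n)] with x hx
  rw [hx, ContinuousMap.sum_apply]
  rfl

/-- Writing `|z|⁴ = |z²|²` makes the quartic norm an `L²` norm of a wave indexed by pairs of
frequencies. -/
theorem eLpNorm_schrodinger_pow_four {f : Lp ℂ 2 (volume : Measure (Torus α))} {N : ℝ}
    (hf : SpectrumIn f N) (t : ℝ) :
    eLpNorm (schrodinger t f) 4 (volume : Measure (Torus α)) ^ 4 =
      ENNReal.ofReal (∫ x : Torus α, ‖wave
        ((Fintype.piFinset fun _ : Fin d => symIcc ⌊N⌋₊) ×ˢ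
          (Fintype.piFinset fun _ : Fin d => symIcc ⌊N⌋₊))
        (fun p => p.1 + p.2) (fun p => symbolQ α p.1 + symbolQ α p.2)
        (fun p => fourierCoefficient f p.1 * fourierCoefficient f p.2) t x‖ ^ 2) := by
  rw [eLpNorm_congr_ae (schrodinger_ae_eq hf t), eLpNorm_four_pow_four,
    ofReal_integral_eq_lintegral_ofReal]
  · refine lintegral_congr fun x => ?_
    rw [← ofReal_norm, ← ENNReal.ofReal_pow (norm_nonneg _),
      show ∀ z : ℂ, ‖z‖ ^ 4 = ‖z * z‖ ^ 2 from fun z => by rw [norm_mul]; ring]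
    congr 3
    rw [wave, Finset.sum_mul_sum, ← Finset.sum_product']
    refine Finset.sum_congr rfl fun p _ => ?_
    rw [character_add]
    have : Complex.exp (-Complex.I * t * (symbolQ α p.1 + symbolQ α p.2 : ℝ)) =
        Complex.exp (-Complex.I * t * symbolQ α p.1) *
          Complex.exp (-Complex.I * t * symbolQ α p.2) := by
      rw [← Complex.exp_add]; push_cast; ring_nf
    rw [this]
    ring
  · refine Continuous.integrable_of_hasCompactSupport ?_ (HasCompactSupport.of_compactSpace _)
    exact (continuous_wave _ _ _ _ t).norm.pow 2
  · exact Filter.Eventually.of_forall fun x => by positivity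

/-- A bound for the number of lattice points in shells implies the `L⁴` Strichartz estimate. -/
theorem strichartzL4_of_shellBound {s : ℝ} (hs : 0 ≤ s) (h : ShellBound d (2 * s)) :
    StrichartzL4 d s := by
  obtain ⟨C, hC, h⟩ := h
  intro T hT
  -- With this `β` the weight is at least `e⁻¹` on `[-T, T]`; the factor `Real.exp 1` in `A`
  -- compensates.
  set β : ℝ := (T ^ 2)⁻¹ with hβdef
  have hβ : 0 < β := by positivity
  set Z : ℝ := ∑' k : ℤ, (1 + (k : ℝ) ^ 2)⁻¹ with hZ
  have hZ0 : 0 ≤ Z := tsum_nonneg fun k => by positivity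
  set A : ℝ := Real.exp 1 * (2 ^ d * Real.sqrt (Real.pi / β) *
    (3 * (1 + 4 * β) * (C * 2 ^ (2 * s)) * Z)) with hA
  have hA0 : 0 ≤ A := by positivity
  refine ⟨Real.sqrt (A + 1), by positivity, ?_⟩
  intro α _ hα N hN f hf
  set M : ℕ := ⌊N⌋₊ with hM
  have hM1 : 1 ≤ M := Nat.le_floor (by simpa using hN)
  have hMN : (M : ℝ) ≤ N := Nat.floor_le (by linarith)
  set S := Fintype.piFinset fun _ : Fin d => symIcc M with hS
  set a : (Fin d → ℤ) → ℂ := fourierCoefficient f with ha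
  set u : ℝ → Torus α → ℂ := wave (S ×ˢ S) (fun p => p.1 + p.2)
    (fun p => symbolQ α p.1 + symbolQ α p.2) (fun p => a p.1 * a p.2) with hu
  set V := ∏ j, α j with hVdef
  have hV : 0 < V := prod_period_pos
  -- Bessel gives `(V Y)²`, while the wave bound has only one factor `V`; the lower bound on the
  -- periods supplies the other uniformly in `α`.
  have hV2 : 1 ≤ 2 ^ d * V := by
    have : (2 : ℝ) ^ d * V = ∏ j, 2 * α j := by
      rw [Finset.prod_mul_distrib, Finset.prod_const, Finset.card_univ, Fintype.card_fin]
    rw [this]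
    calc (1 : ℝ) = ∏ _j : Fin d, 1 := Finset.prod_const_one.symm
      _ ≤ _ := Finset.prod_le_prod (fun _ _ => zero_le_one) fun j _ => by linarith [(hα j).1]
  have hθ : ∀ j, 9 ≤ (2 * Real.pi / α j) ^ 2 ∧ (2 * Real.pi / α j) ^ 2 ≤ 160 := by
    intro j
    obtain ⟨h1, h2⟩ := hα j
    have hj : 0 < α j := by linarith
    have l1 : 3 ≤ 2 * Real.pi / α j := by
      rw [le_div_iff₀ hj]; nlinarith [Real.pi_gt_three]
    have l2 : 2 * Real.pi / α j ≤ 12.6 := by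
      rw [div_le_iff₀ hj]; nlinarith [Real.pi_lt_d2]
    constructor <;> nlinarith
  set B : ℝ := C * 2 ^ (2 * s) * N ^ (2 * s) with hB
  have hB0 : 0 ≤ B := by positivity
  have hcount : ∀ k : Fin d → ℤ, ∀ y : ℝ,
      (((S ×ˢ S).filter fun q => q.1 + q.2 = k ∧ y ≤ symbolQ α q.1 + symbolQ α q.2 ∧
        symbolQ α q.1 + symbolQ α q.2 < y + 1).card : ℝ) ≤ B := by
    intro k y
    refine (Nat.cast_le.2 (card_pairs_le_card_shell M k y)).trans ?_
    refine (h _ hθ (2 * M) (by omega) _).trans ?_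
    rw [hB, mul_assoc, ← Real.mul_rpow (by norm_num) (by linarith)]
    push_cast
    gcongr
  obtain ⟨hint, hle⟩ := integral_gaussian_mul_wave_sq_le (α := α) hβ hB0 (S ×ˢ S)
    (fun p => p.1 + p.2) (fun p => symbolQ α p.1 + symbolQ α p.2) (fun p => a p.1 * a p.2) hcount
  rw [← hu] at hint hle
  have hbsq : ∑ p ∈ S ×ˢ S, ‖a p.1 * a p.2‖ ^ 2 = (∑ n ∈ S, ‖a n‖ ^ 2) ^ 2 := by
    rw [sq (∑ n ∈ S, _), Finset.sum_mul_sum, ← Finset.sum_product']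
    exact Finset.sum_congr rfl fun p _ => by rw [norm_mul, mul_pow]
  have hbessel := sum_norm_fourierCoefficient_sq_le f S
  rw [hbsq, ← hVdef] at hle
  set Y := ∑ n ∈ S, ‖a n‖ ^ 2 with hY
  have hY0 : 0 ≤ Y := Finset.sum_nonneg fun n _ => by positivity
  have hVY : V * Y ^ 2 ≤ 2 ^ d * (‖f‖ ^ 2) ^ 2 := by
    have h1 : (V * Y) ^ 2 ≤ (‖f‖ ^ 2) ^ 2 := by gcongr
    calc V * Y ^ 2 ≤ (2 ^ d * V) * (V * Y ^ 2) := le_mul_of_one_le_left (by positivity) hV2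
      _ = 2 ^ d * (V * Y) ^ 2 := by ring
      _ ≤ _ := by gcongr
  have hfinal : Real.exp 1 * ∫ t : ℝ, Real.exp (-β * t ^ 2) * ∫ x : Torus α, ‖u t x‖ ^ 2 ≤
      (Real.sqrt (A + 1) * N ^ s * ‖f‖ ^ 2) ^ 2 := by
    have hN2 : (N ^ s) ^ 2 = N ^ (2 * s) := by
      rw [← Real.rpow_natCast, ← Real.rpow_mul (by linarith), mul_comm]
      norm_num
    rw [mul_pow, mul_pow, Real.sq_sqrt (by positivity), hN2]
    calc _ ≤ Real.exp 1 * (V * Real.sqrt (Real.pi / β) * (3 * (1 + 4 * β) * B * Z) * Y ^ 2) := by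
          gcongr
      _ = Real.exp 1 * (Real.sqrt (Real.pi / β) * (3 * (1 + 4 * β) * B * Z)) * (V * Y ^ 2) := by
          ring
      _ ≤ Real.exp 1 * (Real.sqrt (Real.pi / β) * (3 * (1 + 4 * β) * B * Z)) *
          (2 ^ d * (‖f‖ ^ 2) ^ 2) := by gcongr
      _ = A * N ^ (2 * s) * (‖f‖ ^ 2) ^ 2 := by rw [hA, hB]; ring
      _ ≤ _ := by gcongr; linarith
  have hpow : (normL4L4 T (fun t => schrodinger t f) ^ 2) ^ 2 ≤
      ENNReal.ofReal (Real.sqrt (A + 1) * N ^ s * ‖f‖ ^ 2) ^ 2 := by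
    rw [← pow_mul, normL4L4, eLpNorm_four_pow_four, ← ENNReal.ofReal_pow (by positivity)]
    calc ∫⁻ t in Set.Icc (-T) T, ‖eLpNorm (schrodinger t f) 4 (volume : Measure (Torus α))‖ₑ ^ 4
        ≤ ∫⁻ t in Set.Icc (-T) T, ENNReal.ofReal
            (Real.exp 1 * (Real.exp (-β * t ^ 2) * ∫ x : Torus α, ‖u t x‖ ^ 2)) := by
          refine setLIntegral_mono' measurableSet_Icc fun t ht => ?_
          rw [enorm_eq_self, eLpNorm_schrodinger_pow_four hf t]
          refine ENNReal.ofReal_le_ofReal ?_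
          rw [← mul_assoc, ← Real.exp_add]
          refine le_mul_of_one_le_left (integral_nonneg fun x => by positivity) ?_
          refine Real.one_le_exp ?_
          have h1 : t ^ 2 ≤ T ^ 2 := sq_le_sq' ht.1 ht.2
          have h2 : β * t ^ 2 ≤ β * T ^ 2 := by gcongr
          have h3 : β * T ^ 2 = 1 := by rw [hβdef]; field_simp
          linarith
      _ ≤ ∫⁻ t : ℝ, ENNReal.ofReal
            (Real.exp 1 * (Real.exp (-β * t ^ 2) * ∫ x : Torus α, ‖u t x‖ ^ 2)) :=
          setLIntegral_le_lintegral _ _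
      _ = ENNReal.ofReal (∫ t : ℝ, Real.exp 1 *
            (Real.exp (-β * t ^ 2) * ∫ x : Torus α, ‖u t x‖ ^ 2)) := by
          refine (ofReal_integral_eq_lintegral_ofReal (hint.const_mul _) ?_).symm
          refine Filter.Eventually.of_forall fun t => ?_
          exact mul_nonneg (Real.exp_pos _).le (mul_nonneg (Real.exp_pos _).le
            (integral_nonneg fun x => by positivity))
      _ ≤ _ := by
          rw [integral_const_mul]
          exact ENNReal.ofReal_le_ofReal hfinal
  exact (ENNReal.pow_le_pow_left_iff two_ne_zero).1 hpow

end Strichartz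

end GeneralTorus

end

theorem proposition1 :
    GeneralTorus.StrichartzL4 2 (1 / 3) ∧
    (∀ d : ℕ, 3 ≤ d → Odd d → ∀ ε : ℝ, 0 < ε →
      GeneralTorus.StrichartzL4 d ((d : ℝ) / 2 - (d : ℝ) / ((d : ℝ) + 1) + ε)) ∧
    (∀ d : ℕ, 4 ≤ d → Even d → ∀ ε : ℝ, 0 < ε →
      GeneralTorus.StrichartzL4 d ((d : ℝ) / 2 - 1 + ε)) := by
  refine ⟨?_, fun d hd _ ε hε => ?_, fun d hd _ ε hε => ?_⟩
  · refine GeneralTorus.strichartzL4_of_shellBound (by norm_num) ?_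
    convert GeneralTorus.shellBound_two using 1
    norm_num
  · have hd' : (3 : ℝ) ≤ d := by exact_mod_cast hd
    have h1 : (d : ℝ) / ((d : ℝ) + 1) ≤ 1 := by
      rw [div_le_one (by linarith)]; linarith
    refine GeneralTorus.strichartzL4_of_shellBound ?_ ?_
    · linarith
    · rcases hd.eq_or_lt with rfl | hd4
      · refine (GeneralTorus.shellBound_three hε).mono ?_
        norm_num
        linarith
      -- For odd `d ≥ 5` the claimed exponent is weaker than `d/2 - 1 + ε`, since `d/(d+1) ≤ 1`, so
      -- the slicing bound suffices.
      · refine (GeneralTorus.shellBound_of_four_le hd4 hε).mono ?_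
        linarith
  · have hd' : (4 : ℝ) ≤ d := by exact_mod_cast hd
    refine GeneralTorus.strichartzL4_of_shellBound (by linarith) ?_
    refine (GeneralTorus.shellBound_of_four_le hd hε).mono ?_
    linarith
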